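/- Let $E=(E^0,E^1,r,s)$ be a row-finite directed graph, i.e. $r^{-1}(v)$ is finite for every $v\in E^0$. Let $C^*(E)$ be its graph $C^*$-algebra, generated by a universal Cuntz–Krieger $E$-family $\{p_v,s_e\}$: the $p_v$ are mutually orthogonal projections, $s_e^*s_e=p_{s(e)}$ for every $e\in E^1$, and $p_v=\sum_{r(e)=v}s_es_e^*$ for every $v\in E^0$ with $r^{-1}(v)\neq\emptyset$. Let $\gamma$ be the gauge action of $\mathbb T$, with $\gamma_z(p_v)=p_v$ and $\gamma_z(s_e)=zs_e$. Let $E^*$ be the set of finite paths $\alpha=\alpha_1\cdots\alpha_n$ with $s(\alpha_i)=r(\alpha_{i+1})$, where $r(\alpha)=r(\alpha_1)$ and $s(\alpha)=s(\alpha_n)$, vertices being the paths of length $0$ (with $r(v)=s(v)=v$); put $s_\alpha=s_{\alpha_1}\cdots s_{\alpha_n}$ and $s_v=p_v$ for a vertex $v$. For a subset $X$ of a $C^*$-algebra $B$ put $X^\perp=\{a\in B: ax=xa=0\text{ for all }x\in X\}$; an ideal $J$ is regular if $J=J^{\perp\perp}$. For $H\subseteq E^0$ put $$I(H)=\overline{\operatorname{span}}\{s_\alpha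 s_\beta^*:\alpha,\beta\in E^*,\ s(\alpha)=s(\beta)\in H\},$$ for an ideal $J$ of $C^*(E)$ put $$H(J)=\{v\in E^0:p_v\in J\},\qquad \overline H(J)=\{r(\alpha):\alpha\in E^*,\ s(\alpha)\in H(J)\},$$ and for $w\in E^0$ put $T(w)=\{s(\alpha):\alpha\in E^*,\ r(\alpha)=w\}$. Let $J$ be a closed two-sided ideal of $C^*(E)$ that is gauge-invariant, i.e. $\gamma_z(J)\subseteq J$ for all $z\in\mathbb T$. Then 1. $J^\perp=I(E^0\setminus\overline H(J))$; 2. $J^{\perp\perp}=I(\{w\in E^0:T(w)\subseteq\overline H(J)\})$; 3. $J$ is regular if and only if $H(J)=\{w\in E^0:T(w)\subseteq\overline H(J)\}$. -/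

import Mathlib

universe u v w

/-- A row-finite directed graph with vertex set `V` and edge set `A`: every vertex is the range of
only finitely many edges. -/
structure RowFiniteGraph (V : Type u) (A : Type v) where
  r : A → V
  s : A → V
  rowFinite : ∀ x : V, (r ⁻¹' {x}).Finite

namespace RowFiniteGraph

/-! ## Paths -/

section Paths

variable {V : Type u} {A : Type v}

/-- `E.Path x y` is the type of finite paths in `E` with source `x` and range `y`, the vertices
being the paths of length zero.  A path `α₁ α₂ … αₙ` satisfies `s αᵢ = r αᵢ₊₁`; its source is `s αₙ`
and its range is `r α₁`. -/
inductive Path (E : RowFiniteGraph V A) : V → V → Type (max u v)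
  | vertex (x : V) : Path E x x
  | cons {x : V} (e : A) (α : Path E x (E.s e)) : Path E x (E.r e)

/-- `T(w)`: the set of sources of paths with range `w`. -/
def T (E : RowFiniteGraph V A) (w : V) : Set V := {x | Nonempty (E.Path x w)}

end Paths

/-! ## Cuntz–Krieger families -/

section Families

variable {V : Type u} {A : Type v}

/-- A Cuntz–Krieger `E`-family in a `*`-ring `B`. -/
structure CKFamily (E : RowFiniteGraph V A) (B : Type w) [NonUnitalRing B] [StarRing B] where
  p : V → B
  s : A → B
  isStarProjection : ∀ x, IsStarProjection (p x)
  orthogonal : ∀ x y, x ≠ y → p x * p y = 0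
  star_s_mul_s : ∀ e, star (s e) * s e = p (E.s e)
  p_eq_sum : ∀ x, (E.r ⁻¹' {x}).Nonempty →
    p x = ∑ e ∈ (E.rowFinite x).toFinset, s e * star (s e)

/-- `s_α` for a path `α`; this is `p_x` for a vertex `x`. -/
def CKFamily.sPath {E : RowFiniteGraph V A} {B : Type w} [NonUnitalRing B] [StarRing B]
    (F : CKFamily E B) : {x y : V} → E.Path x y → B
  | _, _, .vertex x => F.p x
  | _, _, .cons e α => F.s e * F.sPath α

end Families

/-! ## The free `*`-algebra on the symbols `p_x`, `s_e` -/

/-- Letters: the symbols `p_x`, `s_e` and, with flag `true`, their formal adjoints. -/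
abbrev Letter (V : Type u) (A : Type v) : Type (max u v) := (V ⊕ A) × Bool

/-- The free unital complex `*`-algebra on symbols `p_x` (`x ∈ V`) and `s_e` (`e ∈ A`). -/
abbrev FreeStar (V : Type u) (A : Type v) : Type (max u v) :=
  MonoidAlgebra ℂ (FreeMonoid (Letter V A))

namespace FreeStar

variable {V : Type u} {A : Type v}

/-- The adjoint of a word: reverse it and flip every letter. -/
def wordStar (m : FreeMonoid (Letter V A)) : FreeMonoid (Letter V A) :=
  FreeMonoid.ofList ((m.toList.map fun a => (a.1, !a.2)).reverse)

theorem wordStar_mul (m n : FreeMonoid (Letter V A)) :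
    wordStar (m * n) = wordStar n * wordStar m := by
  simp [wordStar]

theorem wordStar_wordStar (m : FreeMonoid (Letter V A)) : wordStar (wordStar m) = m := by
  simp [wordStar, List.map_reverse, Function.comp_def]

/-- The adjoint, as an additive map. -/
noncomputable def starAux : FreeStar V A →+ FreeStar V A :=
  (Finsupp.liftAddHom fun m : FreeMonoid (Letter V A) =>
    (MonoidAlgebra.singleAddHom (R := ℂ) (wordStar m)).comp (starAddEquiv (R := ℂ)).toAddMonoidHom).comp
    MonoidAlgebra.coeffAddEquiv.toAddMonoidHom

theorem starAux_single (m : FreeMonoid (Letter V A)) (c : ℂ) :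
    starAux (MonoidAlgebra.single m c) = MonoidAlgebra.single (wordStar m) (star c) := by
  simp [starAux, MonoidAlgebra.singleAddHom]

noncomputable instance : StarRing (FreeStar V A) where
  star := starAux
  star_involutive x := by
    induction x using MonoidAlgebra.induction_linear with
    | zero => simp
    | add x y hx hy => simp [hx, hy]
    | single m c => simp [starAux_single, wordStar_wordStar]
  star_add := map_add _
  star_mul x y := by
    induction x using MonoidAlgebra.induction_linear with
    | zero => simp
    | add x x' hx hx' => simp [add_mul, mul_add, hx, hx']
    | single m c =>
      induction y using MonoidAlgebra.induction_linear with
      | zero => simp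
      | add y y' hy hy' => simp [add_mul, mul_add, hy, hy']
      | single n d =>
        simp [starAux_single, MonoidAlgebra.single_mul_single, wordStar_mul, mul_comm]

theorem star_single (m : FreeMonoid (Letter V A)) (c : ℂ) :
    star (MonoidAlgebra.single m c : FreeStar V A) =
      MonoidAlgebra.single (wordStar m) (star c) := starAux_single m c

instance : StarModule ℂ (FreeStar V A) where
  star_smul c x := by
    induction x using MonoidAlgebra.induction_linear with
    | zero => simp
    | add x y hx hy => rw [smul_add, star_add, hx, hy, star_add, smul_add]
    | single m d => simp [star_single]

noncomputable def letter (a : Letter V A) : FreeStar V A := MonoidAlgebra.single (FreeMonoid.of a) 1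

/-- The symbol `p_x`. -/
noncomputable def P (x : V) : FreeStar V A := letter (.inl x, false)

/-- The symbol `s_e`. -/
noncomputable def S (e : A) : FreeStar V A := letter (.inr e, false)

theorem star_letter (a : Letter V A) : star (letter a) = letter (a.1, !a.2) := by
  simp [letter, star_single, wordStar]

end FreeStar

/-! ## The universal C*-seminorm for the Cuntz–Krieger relations -/

section Seminorm

variable {V : Type u} {A : Type v}

open FreeStar

/-- The Cuntz–Krieger relations, as equations between elements of the free `*`-algebra. -/
inductive Rel (E : RowFiniteGraph V A) : FreeStar V A → FreeStar V A → Prop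
  | p_selfAdjoint (x : V) : Rel E (star (P x)) (P x)
  | p_idempotent (x : V) : Rel E (P x * P x) (P x)
  | p_orthogonal (x y : V) : x ≠ y → Rel E (P x * P y) 0
  | star_s_mul_s (e : A) : Rel E (star (S e) * S e) (P (E.s e))
  | p_eq_sum (x : V) : (E.r ⁻¹' {x}).Nonempty →
      Rel E (P x) (∑ e ∈ (E.rowFinite x).toFinset, S e * star (S e))

/-- C*-seminorms on the free `*`-algebra that vanish on the Cuntz–Krieger relations. -/
structure CKSeminorm (E : RowFiniteGraph V A) extends RingSeminorm (FreeStar V A) where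
  smul' : ∀ (c : ℂ) x, toFun (c • x) = ‖c‖ * toFun x
  star_mul_self' : ∀ x, toFun (star x * x) = toFun x * toFun x
  rel' : ∀ x y, Rel E x y → toFun (x - y) = 0

namespace CKSeminorm

variable {E : RowFiniteGraph V A}

noncomputable instance : Inhabited (CKSeminorm E) :=
  ⟨{ toFun := fun _ => 0
     map_zero' := rfl
     add_le' := by simp
     neg' := by simp
     mul_le' := by simp
     smul' := by simp
     star_mul_self' := by simp
     rel' := by simp }⟩

variable (N : CKSeminorm E)

theorem nonneg (x : FreeStar V A) : 0 ≤ N.toFun x := by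
  have h := N.add_le' x (-x)
  rw [N.neg', add_neg_cancel, N.map_zero'] at h
  linarith

theorem le_add_sub (x y : FreeStar V A) : N.toFun x ≤ N.toFun y + N.toFun (x - y) := by
  simpa using N.add_le' y (x - y)

theorem star_eq (x : FreeStar V A) : N.toFun (star x) = N.toFun x := by
  have key : ∀ y : FreeStar V A, N.toFun y ≤ N.toFun (star y) := fun y => by
    have h1 := N.mul_le' (star y) y
    rw [N.star_mul_self'] at h1
    rcases (N.nonneg y).eq_or_lt with h | h
    · rw [← h]; exact N.nonneg _
    · exact le_of_mul_le_mul_right h1 h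
  refine le_antisymm ?_ (key x)
  simpa using key (star x)

theorem eq_of_rel {x y : FreeStar V A} (h : Rel E x y) : N.toFun x = N.toFun y := by
  have h1 := N.le_add_sub x y
  have h2 := N.le_add_sub y x
  rw [← neg_sub x y, N.neg', N.rel' x y h] at h2
  rw [N.rel' x y h] at h1
  linarith

theorem le_one_of_sq {t : ℝ} (h : t * t ≤ t) : t ≤ 1 := by
  by_contra hlt
  nlinarith

theorem one_le : N.toFun 1 ≤ 1 := by
  apply le_one_of_sq
  rw [← N.star_mul_self', star_one, mul_one]

theorem P_le (x : V) : N.toFun (P x) ≤ 1 := by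
  apply le_one_of_sq
  rw [← N.star_mul_self']
  have h1 := N.le_add_sub (star (P x) * P x) (P x * P x)
  have h2 := N.mul_le' (star (P x) - P x) (P x)
  rw [N.rel' _ _ (.p_selfAdjoint x), zero_mul, sub_mul] at h2
  rw [N.eq_of_rel (.p_idempotent x)] at h1
  linarith

theorem S_le (e : A) : N.toFun (S e) ≤ 1 := by
  have h1 := N.star_mul_self' (S e)
  rw [N.eq_of_rel (.star_s_mul_s e)] at h1
  have h2 := N.P_le (E.s e)
  by_contra hlt
  nlinarith

theorem letter_le (a : Letter V A) : N.toFun (letter a) ≤ 1 := by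
  rcases a with ⟨x | e, _ | _⟩
  · exact N.P_le x
  · have := N.star_eq (P x)
    rw [P, star_letter] at this
    exact this.trans_le (N.P_le x)
  · exact N.S_le e
  · have := N.star_eq (S e)
    rw [S, star_letter] at this
    exact this.trans_le (N.S_le e)

theorem word_le (m : FreeMonoid (Letter V A)) : N.toFun (MonoidAlgebra.single m 1) ≤ 1 := by
  induction m using FreeMonoid.inductionOn' with
  | one => exact N.one_le
  | of_mul a m ih =>
    have h : (MonoidAlgebra.single (FreeMonoid.of a * m) 1 : FreeStar V A) =
        letter a * MonoidAlgebra.single m 1 := by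
      simp [letter, MonoidAlgebra.single_mul_single]
    rw [h]
    exact (N.mul_le' _ _).trans (mul_le_one₀ (N.letter_le a) (N.nonneg _) ih)

theorem exists_bound (E : RowFiniteGraph V A) (x : FreeStar V A) :
    ∃ C, ∀ N : CKSeminorm E, N.toFun x ≤ C := by
  induction x using MonoidAlgebra.induction_linear with
  | zero => exact ⟨0, fun N => N.map_zero'.le⟩
  | add x y hx hy =>
    obtain ⟨C, hC⟩ := hx
    obtain ⟨D, hD⟩ := hy
    exact ⟨C + D, fun N => (N.add_le' x y).trans (add_le_add (hC N) (hD N))⟩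
  | single m c =>
    refine ⟨‖c‖, fun N => ?_⟩
    have h : (MonoidAlgebra.single m c : FreeStar V A) = c • MonoidAlgebra.single m 1 := by simp
    rw [h, N.smul']
    exact mul_le_of_le_one_right (norm_nonneg _) (N.word_le m)

theorem bddAbove (E : RowFiniteGraph V A) (x : FreeStar V A) :
    BddAbove (Set.range fun N : CKSeminorm E => N.toFun x) := by
  obtain ⟨C, hC⟩ := exists_bound E x
  exact ⟨C, by rintro _ ⟨N, rfl⟩; exact hC N⟩

/-- The largest C*-seminorm vanishing on the Cuntz–Krieger relations. -/
noncomputable def universal (E : RowFiniteGraph V A) : CKSeminorm E where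
  toFun x := ⨆ N : CKSeminorm E, N.toFun x
  map_zero' := by simp [fun N : CKSeminorm E => N.map_zero']
  add_le' x y := ciSup_le fun N => (N.add_le' x y).trans
    (add_le_add (le_ciSup (bddAbove E x) N) (le_ciSup (bddAbove E y) N))
  neg' x := by simp [fun N : CKSeminorm E => N.neg']
  mul_le' x y := ciSup_le fun N => (N.mul_le' x y).trans
    (mul_le_mul (le_ciSup (bddAbove E x) N) (le_ciSup (bddAbove E y) N) (N.nonneg y)
      ((N.nonneg x).trans (le_ciSup (bddAbove E x) N)))
  smul' c x := by
    simp only [fun N : CKSeminorm E => N.smul']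
    exact (Real.mul_iSup_of_nonneg (norm_nonneg c) _).symm
  star_mul_self' x := by
    have h0 : 0 ≤ ⨆ N : CKSeminorm E, N.toFun x := Real.iSup_nonneg fun N => N.nonneg x
    apply le_antisymm
    · refine ciSup_le fun N => ?_
      rw [N.star_mul_self']
      exact mul_self_le_mul_self (N.nonneg x) (le_ciSup (bddAbove E x) N)
    · have h1 : ∀ N : CKSeminorm E,
          N.toFun x ≤ √(⨆ N : CKSeminorm E, N.toFun (star x * x)) := fun N => by
        apply Real.le_sqrt_of_sq_le
        rw [pow_two, ← N.star_mul_self']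
        exact le_ciSup (bddAbove E (star x * x)) N
      have h2 := mul_self_le_mul_self h0 (ciSup_le h1)
      rwa [Real.mul_self_sqrt (Real.iSup_nonneg fun N => N.nonneg _)] at h2
  rel' x y h := by simp [fun N : CKSeminorm E => N.rel' x y h]

theorem le_universal (x : FreeStar V A) : N.toFun x ≤ (universal E).toFun x :=
  le_ciSup (bddAbove E x) N

end CKSeminorm

end Seminorm

/-! ## The enveloping unital C*-algebra -/

section Envelope

variable {V : Type u} {A : Type v}

/-- The free `*`-algebra, carrying the universal C*-seminorm of `E`. -/
def Pre (_ : RowFiniteGraph V A) : Type (max u v) := FreeStar V A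

variable (E : RowFiniteGraph V A)

noncomputable instance : SeminormedRing E.Pre :=
  (CKSeminorm.universal E).toRingSeminorm.toSeminormedRing

noncomputable instance : Algebra ℂ E.Pre := inferInstanceAs (Algebra ℂ (FreeStar V A))

noncomputable instance : StarRing E.Pre := inferInstanceAs (StarRing (FreeStar V A))

instance : StarModule ℂ E.Pre := inferInstanceAs (StarModule ℂ (FreeStar V A))

theorem Pre.norm_def (x : E.Pre) : ‖x‖ = (CKSeminorm.universal E).toFun x := rfl

noncomputable instance : NormedSpace ℂ E.Pre where
  __ : Module ℂ E.Pre := inferInstance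
  norm_smul_le c x := ((CKSeminorm.universal E).smul' c x).le

theorem Pre.norm_star (x : E.Pre) : ‖star x‖ = ‖x‖ := (CKSeminorm.universal E).star_eq x

theorem Pre.norm_star_mul_self (x : E.Pre) : ‖star x * x‖ = ‖x‖ * ‖x‖ :=
  (CKSeminorm.universal E).star_mul_self' x

/-- The Hausdorff completion in the universal C*-seminorm. -/
abbrev Envelope : Type (max u v) := UniformSpace.Completion E.Pre

namespace Envelope

open UniformSpace

variable {E}

theorem uniformContinuous_star : UniformContinuous (star : E.Pre → E.Pre) := by
  refine (LipschitzWith.of_dist_le_mul (K := 1) fun x y => ?_).uniformContinuous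
  rw [dist_eq_norm, dist_eq_norm, ← star_sub, Pre.norm_star]
  simp

noncomputable instance : Star E.Envelope := ⟨Completion.map star⟩

theorem continuous_star' : Continuous (star : E.Envelope → E.Envelope) := Completion.continuous_map

theorem coe_star (x : E.Pre) : ((star x : E.Pre) : E.Envelope) = star (x : E.Envelope) :=
  (Completion.map_coe uniformContinuous_star x).symm

noncomputable instance : StarRing E.Envelope where
  star_involutive x := by
    induction x using Completion.induction_on with
    | hp => exact isClosed_eq (continuous_star'.comp continuous_star') continuous_id
    | ih x => rw [← coe_star, ← coe_star, star_star]
  star_add x y := by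
    induction x, y using Completion.induction_on₂ with
    | hp =>
      exact isClosed_eq (continuous_star'.comp continuous_add)
        ((continuous_star'.comp continuous_fst).add (continuous_star'.comp continuous_snd))
    | ih x y => rw [← Completion.coe_add, ← coe_star, ← coe_star, ← coe_star, star_add,
        Completion.coe_add]
  star_mul x y := by
    induction x, y using Completion.induction_on₂ with
    | hp =>
      exact isClosed_eq (continuous_star'.comp continuous_mul)
        ((continuous_star'.comp continuous_snd).mul (continuous_star'.comp continuous_fst))
    | ih x y => rw [← Completion.coe_mul, ← coe_star, ← coe_star, ← coe_star, star_mul,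
        Completion.coe_mul]

instance : StarModule ℂ E.Envelope where
  star_smul c x := by
    induction x using Completion.induction_on with
    | hp =>
      exact isClosed_eq (continuous_star'.comp (continuous_const_smul c))
        (continuous_star'.const_smul (star c))
    | ih x => rw [← Completion.coe_smul, ← coe_star, ← coe_star, star_smul, Completion.coe_smul]

instance : CStarRing E.Envelope where
  norm_mul_self_le x := by
    refine le_of_eq ?_
    induction x using Completion.induction_on with
    | hp =>
      exact isClosed_eq (continuous_norm.mul continuous_norm)
        (continuous_norm.comp (continuous_star'.mul continuous_id))
    | ih x => rw [← coe_star, ← Completion.coe_mul, Completion.norm_coe, Completion.norm_coe,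
        Pre.norm_star_mul_self]

noncomputable instance : NormedAlgebra ℂ E.Envelope where
  norm_smul_le := norm_smul_le

noncomputable instance : CStarAlgebra E.Envelope where

end Envelope

end Envelope

/-! ## The graph C*-algebra and its universal property -/

section GraphAlgebra

variable {V : Type u} {A : Type v}

open UniformSpace

theorem Envelope.coe_eq_of_rel {E : RowFiniteGraph V A} {x y : FreeStar V A} (h : Rel E x y) :
    ((show E.Pre from x : E.Pre) : E.Envelope) = ((show E.Pre from y : E.Pre) : E.Envelope) := by
  rw [← sub_eq_zero, ← Completion.coe_sub, ← norm_eq_zero, Completion.norm_coe, Pre.norm_def]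
  exact (CKSeminorm.universal E).rel' x y h

/-- The canonical map from the free `*`-algebra to the envelope. -/
noncomputable def Envelope.of (E : RowFiniteGraph V A) (x : FreeStar V A) : E.Envelope :=
  ((show E.Pre from x : E.Pre) : E.Envelope)

/-- The canonical Cuntz–Krieger family in the envelope. -/
noncomputable def Envelope.family (E : RowFiniteGraph V A) : CKFamily E E.Envelope where
  p x := Envelope.of E (FreeStar.P x)
  s e := Envelope.of E (FreeStar.S e)
  isStarProjection x :=
    ⟨(Completion.coe_mul _ _).symm.trans (coe_eq_of_rel (.p_idempotent x)),
      (coe_star _).symm.trans (coe_eq_of_rel (.p_selfAdjoint x))⟩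
  orthogonal x y h := (Completion.coe_mul _ _).symm.trans (coe_eq_of_rel (.p_orthogonal x y h))
  star_s_mul_s e := by
    refine Eq.trans ?_ (coe_eq_of_rel (.star_s_mul_s e))
    rw [of, ← coe_star, ← Completion.coe_mul]
    rfl
  p_eq_sum x h := by
    refine (coe_eq_of_rel (.p_eq_sum x h)).trans ?_
    have h1 : ∀ y : FreeStar V A,
        ((show E.Pre from y : E.Pre) : E.Envelope) = Completion.coeRingHom (show E.Pre from y) :=
      fun y => rfl
    rw [h1]
    refine (map_sum (Completion.coeRingHom (α := E.Pre)) _ _).trans ?_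
    refine Finset.sum_congr rfl fun e _ => ?_
    rw [of, ← coe_star, ← Completion.coe_mul]
    rfl

/-- The C*-subalgebra of the envelope generated by the canonical Cuntz–Krieger family. -/
noncomputable def subalgebra (E : RowFiniteGraph V A) : NonUnitalStarSubalgebra ℂ E.Envelope :=
  (NonUnitalStarAlgebra.adjoin ℂ (Set.range (Envelope.family E).p ∪
    Set.range (Envelope.family E).s)).topologicalClosure

instance (E : RowFiniteGraph V A) : IsClosed (E.subalgebra : Set E.Envelope) :=
  NonUnitalStarSubalgebra.isClosed_topologicalClosure _

/-- The graph C*-algebra `C*(E)`: the C*-algebra generated by a universal Cuntz–Krieger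
`E`-family.  It need not have a unit. -/
def CStar (E : RowFiniteGraph V A) : Type (max u v) := E.subalgebra

noncomputable instance (E : RowFiniteGraph V A) : NonUnitalCStarAlgebra E.CStar :=
  inferInstanceAs (NonUnitalCStarAlgebra E.subalgebra)

/-- The inclusion of `C*(E)` into the enveloping algebra. -/
noncomputable def CStar.incl (E : RowFiniteGraph V A) : E.CStar →⋆ₙₐ[ℂ] E.Envelope where
  toFun x := Subtype.val (p := (· ∈ E.subalgebra)) x
  map_smul' _ _ := rfl
  map_zero' := rfl
  map_add' _ _ := rfl
  map_mul' _ _ := rfl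
  map_star' _ := rfl

theorem CStar.incl_injective (E : RowFiniteGraph V A) : Function.Injective (CStar.incl E) :=
  Subtype.val_injective

/-- The universal Cuntz–Krieger `E`-family `{p_x, s_e}` in `C*(E)`. -/
noncomputable def family (E : RowFiniteGraph V A) : CKFamily E E.CStar where
  p x := ⟨(Envelope.family E).p x, NonUnitalStarSubalgebra.le_topologicalClosure _
    (NonUnitalStarAlgebra.subset_adjoin ℂ _ (.inl ⟨x, rfl⟩))⟩
  s e := ⟨(Envelope.family E).s e, NonUnitalStarSubalgebra.le_topologicalClosure _
    (NonUnitalStarAlgebra.subset_adjoin ℂ _ (.inr ⟨e, rfl⟩))⟩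
  isStarProjection x :=
    ⟨CStar.incl_injective E ((Envelope.family E).isStarProjection x).isIdempotentElem,
      CStar.incl_injective E ((Envelope.family E).isStarProjection x).isSelfAdjoint⟩
  orthogonal x y h := CStar.incl_injective E ((Envelope.family E).orthogonal x y h)
  star_s_mul_s e := CStar.incl_injective E ((Envelope.family E).star_s_mul_s e)
  p_eq_sum x h := CStar.incl_injective E <| by
    rw [map_sum]
    exact (Envelope.family E).p_eq_sum x h

theorem CStar.dense_adjoin (E : RowFiniteGraph V A) :
    Dense (NonUnitalStarAlgebra.adjoin ℂ (Set.range E.family.p ∪ Set.range E.family.s) :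
      Set E.CStar) := by
  have hincl : Topology.IsInducing (CStar.incl E) := Topology.IsInducing.subtypeVal
  have himg : CStar.incl E '' (NonUnitalStarAlgebra.adjoin ℂ
      (Set.range E.family.p ∪ Set.range E.family.s) : Set E.CStar) =
      NonUnitalStarAlgebra.adjoin ℂ (Set.range (Envelope.family E).p ∪
        Set.range (Envelope.family E).s) := by
    have h := NonUnitalStarAlgHom.map_adjoin (CStar.incl E)
      (Set.range E.family.p ∪ Set.range E.family.s)
    rw [Set.image_union, ← Set.range_comp, ← Set.range_comp] at h
    exact congrArg (fun S : NonUnitalStarSubalgebra ℂ E.Envelope => (S : Set E.Envelope)) h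
  rw [hincl.dense_iff]
  intro x
  rw [himg]
  exact Subtype.property (p := (· ∈ E.subalgebra)) x

/-- A `*`-homomorphism out of `C*(E)` is determined by its values on the generators. -/
theorem CStar.hom_ext {E : RowFiniteGraph V A} {B : Type w} [NonUnitalCStarAlgebra B]
    {φ ψ : E.CStar →⋆ₙₐ[ℂ] B} (hp : ∀ x, φ (E.family.p x) = ψ (E.family.p x))
    (hs : ∀ e, φ (E.family.s e) = ψ (E.family.s e)) : φ = ψ := by
  have hc : ∀ θ : E.CStar →⋆ₙₐ[ℂ] B, Continuous θ := fun θ =>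
    AddMonoidHomClass.continuous_of_bound θ 1 fun x => by
      simpa using NonUnitalStarAlgHom.norm_apply_le θ x
  refine DFunLike.coe_injective ((hc φ).ext_on (CStar.dense_adjoin E) (hc ψ) fun x hx => ?_)
  induction hx using NonUnitalStarAlgebra.adjoin_induction with
  | mem x hx =>
    rcases hx with ⟨y, rfl⟩ | ⟨e, rfl⟩
    · exact hp y
    · exact hs e
  | add x y _ _ hx hy => rw [map_add, map_add, hx, hy]
  | zero => rw [map_zero, map_zero]
  | mul x y _ _ hx hy => rw [map_mul, map_mul, hx, hy]
  | smul c x _ hx => rw [map_smul, map_smul, hx]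
  | star x _ hx => rw [map_star, map_star, hx]

section Unital

variable {E : RowFiniteGraph V A} {D : Type w} [CStarAlgebra D] (F : CKFamily E D)

/-- Evaluation of a letter at a Cuntz–Krieger family. -/
def CKFamily.evalLetter : Letter V A → D
  | (.inl x, false) => F.p x
  | (.inl x, true) => star (F.p x)
  | (.inr e, false) => F.s e
  | (.inr e, true) => star (F.s e)

theorem CKFamily.evalLetter_flip (a : Letter V A) :
    F.evalLetter (a.1, !a.2) = star (F.evalLetter a) := by
  rcases a with ⟨x | e, _ | _⟩ <;> simp [evalLetter]

/-- Evaluation of elements of the free `*`-algebra at a Cuntz–Krieger family. -/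
noncomputable def CKFamily.eval : FreeStar V A →ₐ[ℂ] D :=
  MonoidAlgebra.lift ℂ D _ (FreeMonoid.lift F.evalLetter)

theorem CKFamily.eval_letter (a : Letter V A) : F.eval (FreeStar.letter a) = F.evalLetter a := by
  simp [eval, FreeStar.letter]

theorem CKFamily.eval_P (x : V) : F.eval (FreeStar.P x) = F.p x := F.eval_letter _

theorem CKFamily.eval_S (e : A) : F.eval (FreeStar.S e) = F.s e := F.eval_letter _

theorem CKFamily.eval_star (x : FreeStar V A) : F.eval (star x) = star (F.eval x) := by
  have hw : ∀ m : FreeMonoid (Letter V A), FreeMonoid.lift F.evalLetter (FreeStar.wordStar m) =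
      star (FreeMonoid.lift F.evalLetter m) := fun m => by
    induction m using FreeMonoid.inductionOn' with
    | one => simp [FreeStar.wordStar]
    | of_mul a m ih =>
      rw [FreeStar.wordStar_mul, map_mul, map_mul, star_mul, ih]
      congr 1
      simp [FreeStar.wordStar, evalLetter_flip]
  induction x using MonoidAlgebra.induction_linear with
  | zero => simp
  | add x y hx hy => rw [star_add, map_add, map_add, star_add, hx, hy]
  | single m c => simp [FreeStar.star_single, eval, MonoidAlgebra.lift_single, hw]

theorem CKFamily.eval_rel {x y : FreeStar V A} (h : Rel E x y) : F.eval x = F.eval y := by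
  cases h with
  | p_selfAdjoint x => rw [eval_star, eval_P]; exact (F.isStarProjection x).isSelfAdjoint
  | p_idempotent x => rw [map_mul, eval_P]; exact (F.isStarProjection x).isIdempotentElem
  | p_orthogonal x y h => rw [map_mul, eval_P, eval_P, map_zero]; exact F.orthogonal x y h
  | star_s_mul_s e => rw [map_mul, eval_star, eval_S, eval_P]; exact F.star_s_mul_s e
  | p_eq_sum x h =>
    rw [map_sum, eval_P, F.p_eq_sum x h]
    simp only [map_mul, eval_star, eval_S]

/-- The C*-seminorm induced by a Cuntz–Krieger family. -/
noncomputable def CKFamily.seminorm : CKSeminorm E where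
  toFun x := ‖F.eval x‖
  map_zero' := by simp
  add_le' x y := by rw [map_add]; exact norm_add_le _ _
  neg' x := by rw [map_neg, norm_neg]
  mul_le' x y := by rw [map_mul]; exact norm_mul_le _ _
  smul' c x := by rw [map_smul, norm_smul]
  star_mul_self' x := by rw [map_mul, eval_star, CStarRing.norm_star_mul_self]
  rel' x y h := by rw [map_sub, F.eval_rel h, sub_self, norm_zero]

/-- Evaluation at a Cuntz–Krieger family, as a ring homomorphism on the seminormed algebra. -/
noncomputable def CKFamily.evalPre : E.Pre →+* D := F.eval.toRingHom

theorem CKFamily.continuous_evalPre : Continuous F.evalPre :=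
  AddMonoidHomClass.continuous_of_bound F.evalPre 1 fun x => by
    rw [one_mul]
    exact F.seminorm.le_universal x

/-- Extension of the evaluation map to the envelope. -/
noncomputable def Envelope.lift : E.Envelope →⋆ₙₐ[ℂ] D where
  toFun := Completion.extensionHom F.evalPre F.continuous_evalPre
  map_smul' c x := by
    have hcont : Continuous (Completion.extensionHom F.evalPre F.continuous_evalPre) :=
      Completion.continuous_extension
    induction x using Completion.induction_on with
    | hp => exact isClosed_eq (hcont.comp (continuous_const_smul c)) (hcont.const_smul c)
    | ih x =>
      rw [← Completion.coe_smul, Completion.extensionHom_coe, Completion.extensionHom_coe]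
      exact map_smul F.eval c _
  map_zero' := map_zero _
  map_add' := map_add _
  map_mul' := map_mul _
  map_star' x := by
    have hcont : Continuous (Completion.extensionHom F.evalPre F.continuous_evalPre) :=
      Completion.continuous_extension
    change Completion.extensionHom F.evalPre F.continuous_evalPre (star x) =
      star (Completion.extensionHom F.evalPre F.continuous_evalPre x)
    induction x using Completion.induction_on with
    | hp =>
      exact isClosed_eq (hcont.comp Envelope.continuous_star') (continuous_star.comp hcont)
    | ih x =>
      rw [← Envelope.coe_star, Completion.extensionHom_coe, Completion.extensionHom_coe]
      exact F.eval_star _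

theorem Envelope.lift_of (x : FreeStar V A) : Envelope.lift F (Envelope.of E x) = F.eval x :=
  Completion.extensionHom_coe F.evalPre F.continuous_evalPre _

end Unital

section Lift

variable {E : RowFiniteGraph V A} {B : Type w} [NonUnitalCStarAlgebra B] (F : CKFamily E B)

/-- The image of a Cuntz–Krieger family in the unitization. -/
noncomputable def CKFamily.unitize : CKFamily E (Unitization ℂ B) where
  p x := (F.p x : Unitization ℂ B)
  s e := (F.s e : Unitization ℂ B)
  isStarProjection x := Unitization.isStarProjection_inr_iff.2 (F.isStarProjection x)
  orthogonal x y h := by rw [← Unitization.inr_mul, F.orthogonal x y h, Unitization.inr_zero]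
  star_s_mul_s e := by rw [← Unitization.inr_star, ← Unitization.inr_mul, F.star_s_mul_s]
  p_eq_sum x h := by
    rw [F.p_eq_sum x h]
    refine (map_sum (Unitization.inrNonUnitalStarAlgHom ℂ B)
      (fun e => F.s e * star (F.s e)) (E.rowFinite x).toFinset).trans ?_
    refine Finset.sum_congr rfl fun e _ => ?_
    rw [← Unitization.inr_star, ← Unitization.inr_mul]
    rfl

theorem CStar.fst_lift (x : E.CStar) :
    (Envelope.lift F.unitize (CStar.incl E x)).fst = 0 := by
  have hc : Continuous (Envelope.lift F.unitize) :=
    AddMonoidHomClass.continuous_of_bound _ 1 fun x => by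
      simpa using NonUnitalStarAlgHom.norm_apply_le (Envelope.lift F.unitize) x
  have hi : Continuous (CStar.incl E) := continuous_subtype_val
  have hf : Continuous fun x : Unitization ℂ B => x.fst :=
    Unitization.uniformContinuous_fst.continuous
  refine congrFun ((hf.comp (hc.comp hi)).ext_on (CStar.dense_adjoin E)
    (continuous_const (y := (0 : ℂ))) fun x hx => ?_) x
  change (Envelope.lift F.unitize (CStar.incl E x)).fst = 0
  induction hx using NonUnitalStarAlgebra.adjoin_induction with
  | mem x hx =>
    rcases hx with ⟨y, rfl⟩ | ⟨e, rfl⟩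
    · have h : Envelope.lift F.unitize (CStar.incl E (E.family.p y)) = (F.p y : Unitization ℂ B) :=
        (Envelope.lift_of F.unitize _).trans (F.unitize.eval_P y)
      rw [h, Unitization.fst_inr]
    · have h : Envelope.lift F.unitize (CStar.incl E (E.family.s e)) = (F.s e : Unitization ℂ B) :=
        (Envelope.lift_of F.unitize _).trans (F.unitize.eval_S e)
      rw [h, Unitization.fst_inr]
  | add x y _ _ hx hy => rw [map_add, map_add, Unitization.fst_add, hx, hy, add_zero]
  | zero => simp
  | mul x y _ _ hx hy => rw [map_mul, map_mul, Unitization.fst_mul, hx, hy, zero_mul]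
  | smul c x _ hx => rw [map_smul, map_smul, Unitization.fst_smul, hx, smul_zero]
  | star x _ hx => rw [map_star, map_star, Unitization.fst_star, hx, star_zero]

/-- The universal property of `C*(E)`: a Cuntz–Krieger `E`-family in any C*-algebra `B` induces a
`*`-homomorphism `C*(E) → B`. -/
noncomputable def CStar.lift : E.CStar →⋆ₙₐ[ℂ] B where
  toFun x := (Envelope.lift F.unitize (CStar.incl E x)).snd
  map_smul' c x := by simp
  map_zero' := by simp
  map_add' x y := by simp
  map_mul' x y := by simp [CStar.fst_lift]
  map_star' x := by simp [map_star]

theorem CStar.lift_p (x : V) : CStar.lift F (E.family.p x) = F.p x :=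
  congrArg (fun u : Unitization ℂ B => u.snd) ((Envelope.lift_of F.unitize _).trans (F.unitize.eval_P x))

theorem CStar.lift_s (e : A) : CStar.lift F (E.family.s e) = F.s e :=
  congrArg (fun u : Unitization ℂ B => u.snd) ((Envelope.lift_of F.unitize _).trans (F.unitize.eval_S e))

/-- `{p_x, s_e}` is a universal Cuntz–Krieger `E`-family. -/
theorem CStar.existsUnique_hom : ∃! φ : E.CStar →⋆ₙₐ[ℂ] B,
    (∀ x, φ (E.family.p x) = F.p x) ∧ ∀ e, φ (E.family.s e) = F.s e :=
  ⟨CStar.lift F, ⟨CStar.lift_p F, CStar.lift_s F⟩, fun _ h =>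
    CStar.hom_ext (fun x => (h.1 x).trans (CStar.lift_p F x).symm)
      fun e => (h.2 e).trans (CStar.lift_s F e).symm⟩

end Lift

end GraphAlgebra

/-! ## The gauge action and ideals -/

section Ideals

variable {V : Type u} {A : Type v}

/-- The Cuntz–Krieger family `{p_x, z s_e}` for `z` in the unit circle. -/
noncomputable def gaugeFamily (E : RowFiniteGraph V A) (z : Circle) : CKFamily E E.CStar where
  p := E.family.p
  s e := (z : ℂ) • E.family.s e
  isStarProjection := E.family.isStarProjection
  orthogonal := E.family.orthogonal
  star_s_mul_s e := by
    have hz : star (z : ℂ) * (z : ℂ) = 1 := by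
      rw [mul_comm]; simp [Complex.mul_conj', Circle.norm_coe]
    rw [star_smul, smul_mul_smul_comm, hz, one_smul, E.family.star_s_mul_s]
  p_eq_sum x h := by
    have hz : (z : ℂ) * star (z : ℂ) = 1 := by
      simp [Complex.mul_conj', Circle.norm_coe]
    rw [E.family.p_eq_sum x h]
    refine Finset.sum_congr rfl fun e _ => ?_
    rw [star_smul, smul_mul_smul_comm, hz, one_smul]

/-- The gauge action: `γ_z` fixes every `p_x` and maps `s_e` to `z s_e`. -/
noncomputable def gauge (E : RowFiniteGraph V A) (z : Circle) : E.CStar →⋆ₙₐ[ℂ] E.CStar :=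
  CStar.lift (E.gaugeFamily z)

variable {E : RowFiniteGraph V A}

/-- `J` is gauge-invariant: `γ_z(J) ⊆ J` for all `z` in the circle (hence `γ_z(J) = J`). -/
def IsGaugeInvariant (J : TwoSidedIdeal E.CStar) : Prop :=
  ∀ (z : Circle), ∀ a ∈ J, E.gauge z a ∈ J

/-- `H(J)`: the set of vertices whose projection lies in `J`. -/
def vertexSet (J : TwoSidedIdeal E.CStar) : Set V := {x | E.family.p x ∈ J}

/-- `H̄(J)`: the set of ranges of paths whose source lies in `H(J)`. -/
def vertexSetBar (J : TwoSidedIdeal E.CStar) : Set V :=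
  {y | ∃ x ∈ vertexSet J, Nonempty (E.Path x y)}

/-- `I(H)`: the closed linear span of the elements `s_α s_β^*`, where `α` and `β` are paths with
common source in `H`. -/
def idealOf (E : RowFiniteGraph V A) (H : Set V) : Set E.CStar :=
  closure (Submodule.span ℂ {a : E.CStar | ∃ x ∈ H, ∃ (y y' : V) (α : E.Path x y) (β : E.Path x y'),
    a = E.family.sPath α * star (E.family.sPath β)} : Set E.CStar)

/-- `X^⊥`: the two-sided annihilator of a subset `X` of a ring. -/
def perp {B : Type w} [NonUnitalRing B] (X : Set B) : Set B :=
  {a | ∀ x ∈ X, a * x = 0 ∧ x * a = 0}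

/-- An ideal `J` is regular if `J = J^⊥⊥`. -/
def IsRegularIdeal {B : Type w} [NonUnitalRing B] (J : TwoSidedIdeal B) : Prop :=
  (J : Set B) = perp (perp (J : Set B))

end Ideals

end RowFiniteGraph

/-! ### Ideals and projections in C*-algebras -/

section CStarIdeals

open Filter Topology

variable {B : Type*} [NonUnitalCStarAlgebra B]

attribute [local instance] CStarAlgebra.spectralOrder CStarAlgebra.spectralOrderedRing

/-! The engine is that a closed gauge-invariant ideal K equals I(H) for H = {x : p_x ∈ K}
(`eq_pathIdeal_of_gaugeInvariant`). Annihilators of such ideals are again closed and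
gauge-invariant, so J, J^⊥ and J^⊥⊥ are all determined by the vertices they contain. Now p_w ∈ J^⊥
exactly when w ∉ H̄(J): a path α from H(J) to w gives s_α ∈ J with p_w s_α = s_α ≠ 0, and if there
is none, p_w kills every s_α s_β^* spanning J. Using this twice turns the double annihilator into
I({w : T(w) ⊆ H̄(J)}), and part 3 compares vertex sets.

For the engine, let b be a spectral component of some a ∈ K. Averaging over the circle keeps b in K;
by Fourier analysis a ∈ I(H) once every b is, and since I(H) is a closed self-adjoint ideal it
suffices that b^*b ∈ I(H). That element is gauge-fixed, hence a limit of combinations of matrix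
units s_α s_β^*, where for a common n each path has length n, or is shorter and starts at a vertex
receiving no edge. Split such a combination into a part with sources in H and a part y with sources
outside H. Then y lies in a finite-dimensional *-algebra meeting K only in 0, on which the quotient
map by K is isometric (`norm_le_norm_sub_of_disjoint`). So y is no larger than the approximation
error, and the limit lies in I(H).

That p_x ≠ 0, needed for s_α ≠ 0, is seen in an explicit representation on ℓ²(V × ℕ). -/

theorem CStarAlgebra.exists_approximateUnit (B : Type*) [NonUnitalCStarAlgebra B] :
    ∃ l : Filter B, l.NeBot ∧ (∀ a, Tendsto (a * ·) l (𝓝 a)) ∧ (∀ a, Tendsto (· * a) l (𝓝 a)) ∧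
      ∀ᶠ u in l, ‖u‖ ≤ 1 ∧ IsSelfAdjoint u :=
  have hu := CStarAlgebra.increasingApproximateUnit B
  ⟨_, hu.neBot, hu.tendsto_mul_left, hu.tendsto_mul_right,
    hu.eventually_norm.and hu.eventually_isSelfAdjoint⟩

/-- With x = b^*b and u running through an approximate unit of N itself, ‖b - bu‖² = ‖(x - xu) - u(x
- xu)‖ ≤ 2‖x - xu‖ → 0, and each bu lies in N. -/
theorem NonUnitalStarSubalgebra.mem_of_star_mul_self_mem (N : NonUnitalStarSubalgebra ℂ B)
    (hN : IsClosed (N : Set B)) (hl : ∀ a, ∀ n ∈ N, a * n ∈ N) {b : B} (hb : star b * b ∈ N) :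
    b ∈ N := by
  have : IsClosed (N : Set B) := hN
  obtain ⟨l, _, hul, -, hu⟩ := CStarAlgebra.exists_approximateUnit N
  let x : N := ⟨star b * b, hb⟩
  have h1 : Tendsto (fun u : N => x - x * u) l (𝓝 0) := by
    simpa using (hul x).const_sub x
  have h2 : Tendsto (fun u : N => ‖x - x * u‖ + ‖x - x * u‖) l (𝓝 0) := by
    simpa using h1.norm.add h1.norm
  have h3 : Tendsto (fun u : N => ‖b - b * u‖ * ‖b - b * u‖) l (𝓝 0) := by
    refine tendsto_of_tendsto_of_tendsto_of_le_of_le' tendsto_const_nhds h2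
      (.of_forall fun u => by positivity) ?_
    filter_upwards [hu] with u ⟨hu1, hu2⟩
    have hsu : star (u : B) = u := congrArg Subtype.val hu2.star_eq
    rw [← CStarRing.norm_star_mul_self]
    have : star (b - b * u) * (b - b * u) = ((x - x * u - u * (x - x * u) : N) : B) := by
      simp only [star_sub, star_mul, hsu, x, NonUnitalStarSubalgebra.coe_sub,
        NonUnitalStarSubalgebra.coe_mul]
      noncomm_ring
    rw [this]
    calc _ ≤ ‖x - x * u‖ + ‖u * (x - x * u)‖ := norm_sub_le _ _
      _ ≤ _ := by
        gcongr
        exact (norm_mul_le _ _).trans (mul_le_of_le_one_left (norm_nonneg _) hu1)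
  have h4 : Tendsto (fun u : N => b * (u : B)) l (𝓝 b) := by
    rw [tendsto_iff_norm_sub_tendsto_zero]
    have := h3.sqrt
    simp only [Real.sqrt_zero] at this
    refine this.congr fun u => ?_
    rw [Real.sqrt_mul_self (norm_nonneg _), norm_sub_rev]
  exact hN.mem_of_tendsto h4 (.of_forall fun u => hl _ _ u.2)

/-- A `TwoSidedIdeal` is only a ring ideal, so scalars have to be recovered: c a is the limit of (c
u) a along an approximate unit. -/
theorem TwoSidedIdeal.smul_mem_of_isClosed (J : TwoSidedIdeal B) (hJ : IsClosed (J : Set B))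
    (c : ℂ) {a : B} (ha : a ∈ J) : c • a ∈ J := by
  obtain ⟨l, _, -, hu, -⟩ := CStarAlgebra.exists_approximateUnit B
  have h := (hu a).const_smul c
  refine hJ.mem_of_tendsto h (.of_forall fun u => ?_)
  rw [← smul_mul_assoc]
  exact J.mul_mem_left _ _ ha

/-- This is isometry of an injective *-homomorphism, here M → B/K, without the C*-structure on B/K.
Finite dimension bounds ‖z‖ by a constant C times the quotient norm, and repeated squaring improves
C to 1 on self-adjoint elements. -/
theorem norm_le_norm_sub_of_disjoint (M K : Submodule ℂ B) [FiniteDimensional ℂ M]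
    (hM : ∀ x ∈ M, ∀ y ∈ M, x * y ∈ M) (hMs : ∀ x ∈ M, star x ∈ M)
    (hK : IsClosed (K : Set B)) (hl : ∀ a, ∀ k ∈ K, a * k ∈ K) (hr : ∀ a, ∀ k ∈ K, k * a ∈ K)
    (hMK : ∀ x ∈ M, x ∈ K → x = 0) {y k : B} (hy : y ∈ M) (hk : k ∈ K) : ‖y‖ ≤ ‖y - k‖ := by
  have : IsClosed (K : Set B) := hK
  obtain ⟨C, hC0, hC⟩ := LinearMap.exists_antilipschitzWith (K.mkQ.comp M.subtype) (by
    rw [LinearMap.ker_eq_bot']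
    rintro ⟨m, hm⟩ h
    have : m ∈ K := by simpa using h
    exact Subtype.ext (hMK m hm this))
  have bound : ∀ z ∈ M, ∀ j ∈ K, ‖z‖ ≤ C * ‖z - j‖ := by
    intro z hz j hj
    have h1 : ‖z‖ ≤ C * ‖K.mkQ z‖ := by
      simpa using hC.le_mul_dist ⟨z, hz⟩ 0
    refine h1.trans ?_
    gcongr
    have : K.mkQ z = K.mkQ (z - j) := by
      rw [map_sub, (Submodule.Quotient.mk_eq_zero K (x := j)).2 hj |> (show K.mkQ j = 0 from ·),
        sub_zero]
    rw [this]
    exact Submodule.Quotient.norm_mk_le K _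
  -- Squaring leaves C unchanged: z² minus a suitable element of K is (z - j)², while ‖z²‖ = ‖z‖².
  have iter : ∀ n : ℕ, ∀ z ∈ M, IsSelfAdjoint z → ∀ j ∈ K,
      ‖z‖ ^ (2 ^ n) ≤ C * ‖z - j‖ ^ (2 ^ n) := by
    intro n
    induction n with
    | zero => intro z hz _ j hj; simpa using bound z hz j hj
    | succ n ih =>
      intro z hz hs j hj
      have h := ih (z * z) (hM z hz z hz) (by rw [isSelfAdjoint_iff, star_mul, hs.star_eq])
        (z * j + j * z - j * j)
        (K.sub_mem (K.add_mem (hl _ _ hj) (hr _ _ hj)) (hl _ _ hj))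
      have e : z * z - (z * j + j * z - j * j) = (z - j) * (z - j) := by noncomm_ring
      have e2 : ‖z * z‖ = ‖z‖ * ‖z‖ := by
        simpa only [hs.star_eq] using CStarRing.norm_star_mul_self (x := z)
      rw [e, e2] at h
      rw [pow_succ' 2 n, pow_mul, pow_mul, pow_two, pow_two]
      refine h.trans ?_
      gcongr
      exact norm_mul_le _ _
  have sa : ∀ z ∈ M, IsSelfAdjoint z → ∀ j ∈ K, ‖z‖ ≤ ‖z - j‖ := by
    intro z hz hs j hj
    by_contra! hlt
    have hz0 : 0 < ‖z‖ := (norm_nonneg _).trans_lt hlt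
    have hq : ‖z - j‖ / ‖z‖ < 1 := (div_lt_one hz0).2 hlt
    have ht : Tendsto (fun n : ℕ => C * (‖z - j‖ / ‖z‖) ^ (2 ^ n)) atTop (𝓝 (C * 0)) :=
      ((tendsto_pow_atTop_nhds_zero_of_lt_one (by positivity) hq).comp
        (tendsto_pow_atTop_atTop_of_one_lt one_lt_two)).const_mul _
    rw [mul_zero] at ht
    have : (1 : ℝ) ≤ 0 := ge_of_tendsto' ht fun n => by
      rw [div_pow, ← mul_div_assoc, le_div_iff₀ (by positivity), one_mul]
      exact iter n z hz hs j hj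
    linarith
  rcases eq_or_ne y 0 with rfl | hy0
  · simp
  -- The self-adjoint case for y^*y and y^*k gives ‖y‖² ≤ ‖y^*‖ ‖y - k‖.
  have h := sa (star y * y) (hM _ (hMs y hy) _ hy) (IsSelfAdjoint.star_mul_self y)
    (star y * k) (hl _ _ hk)
  rw [← mul_sub, CStarRing.norm_star_mul_self] at h
  have h' := h.trans (norm_mul_le _ _)
  rw [norm_star] at h'
  exact le_of_mul_le_mul_left h' (norm_pos_iff.2 hy0)

/-- With p the sum, the positive elements (q_j - q_j p)^*(q_j - q_j p) add up to p - p - p + p = 0,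
so each vanishes. -/
theorem IsStarProjection.mul_sum_eq {ι : Type*} {s : Finset ι} {q : ι → B}
    (hq : ∀ i ∈ s, IsStarProjection (q i)) (hp : IsStarProjection (∑ i ∈ s, q i)) {i : ι}
    (hi : i ∈ s) : q i * ∑ j ∈ s, q j = q i := by
  set p := ∑ j ∈ s, q j with hpdef
  have hf : ∀ j ∈ s, star (q j - q j * p) * (q j - q j * p) =
      q j - p * q j - q j * p + p * q j * p := by
    intro j hj
    have h1 := (hq j hj).isSelfAdjoint.star_eq
    have h2 := hp.isSelfAdjoint.star_eq
    have h3 : q j * q j = q j := (hq j hj).isIdempotentElem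
    simp only [star_sub, star_mul, h1, h2, sub_mul, mul_sub, h3, mul_assoc]
    simp only [← mul_assoc, h3]
    simp only [mul_assoc]
    abel
  have hsum : ∑ j ∈ s, star (q j - q j * p) * (q j - q j * p) = 0 := by
    have h3 : p * p = p := hp.isIdempotentElem
    rw [Finset.sum_congr rfl hf, Finset.sum_add_distrib, Finset.sum_sub_distrib,
      Finset.sum_sub_distrib, ← Finset.mul_sum, ← Finset.sum_mul, ← Finset.sum_mul,
      ← Finset.mul_sum, ← hpdef, h3, h3]
    simp
  have h0 := (Finset.sum_eq_zero_iff_of_nonneg fun j _ => star_mul_self_nonneg _).1 hsum i hi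
  rw [CStarRing.star_mul_self_eq_zero_iff, sub_eq_zero] at h0
  exact h0.symm

/-- Compressing the sum by q_j gives ∑ q_j q_k q_j = q_j. The term k = j already accounts for q_j,
so the other terms, being positive, vanish. This yields the orthogonality of the ranges of the s_e,
which is not among the Cuntz–Krieger axioms. -/
theorem IsStarProjection.mul_eq_zero_of_sum {ι : Type*} {s : Finset ι} {q : ι → B}
    (hq : ∀ i ∈ s, IsStarProjection (q i)) (hp : IsStarProjection (∑ i ∈ s, q i)) {i j : ι}
    (hi : i ∈ s) (hj : j ∈ s) (hij : i ≠ j) : q i * q j = 0 := by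
  classical
  have hjj : q j * q j = q j := (hq j hj).isIdempotentElem
  have h1 : ∑ k ∈ s, star (q k * q j) * (q k * q j) = q j := by
    have : ∀ k ∈ s, star (q k * q j) * (q k * q j) = q j * q k * q j := by
      intro k hk
      have h3 : q k * q k = q k := (hq k hk).isIdempotentElem
      rw [star_mul, (hq k hk).isSelfAdjoint.star_eq, (hq j hj).isSelfAdjoint.star_eq, mul_assoc,
        ← mul_assoc (q k), h3, mul_assoc]
    rw [Finset.sum_congr rfl this, ← Finset.sum_mul, ← Finset.mul_sum,
      IsStarProjection.mul_sum_eq hq hp hj, hjj]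
  rw [← Finset.add_sum_erase s _ hj] at h1
  have h2 : star (q j * q j) * (q j * q j) = q j := by
    rw [hjj, (hq j hj).isSelfAdjoint.star_eq, hjj]
  rw [h2, add_eq_left] at h1
  have h0 := (Finset.sum_eq_zero_iff_of_nonneg fun j _ => star_mul_self_nonneg _).1 h1 i
    (Finset.mem_erase.2 ⟨hij, hi⟩)
  rwa [CStarRing.star_mul_self_eq_zero_iff] at h0

end CStarIdeals

/-! ### A representation with nonzero vertex projections -/

namespace RowFiniteGraph

section Representation

open ContinuousLinearMap

/-- The Hilbert space with orthonormal basis indexed by `ι`. -/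
abbrev SquareSummable (ι : Type*) : Type _ := lp (fun _ : ι => ℂ) 2

/-- The standard orthonormal basis of `SquareSummable ι`. -/
noncomputable def stdHilbertBasis (ι : Type*) : HilbertBasis ι ℂ (SquareSummable ι) :=
  HilbertBasis.ofRepr (LinearIsometryEquiv.refl ℂ _)

theorem stdHilbertBasis_apply {ι : Type*} [DecidableEq ι] (i : ι) :
    stdHilbertBasis ι i = lp.single 2 i (1 : ℂ) := by
  classical
  rw [← HilbertBasis.repr_symm_single]
  rfl

theorem ext_stdHilbertBasis {ι : Type*} {H : Type*} [NormedAddCommGroup H] [NormedSpace ℂ H]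
    {T S : SquareSummable ι →L[ℂ] H}
    (h : ∀ i, T (stdHilbertBasis ι i) = S (stdHilbertBasis ι i)) : T = S := by
  refine ContinuousLinearMap.ext_on (s := Set.range (stdHilbertBasis ι)) ?_ ?_
  · rw [dense_iff_closure_eq, ← Submodule.topologicalClosure_coe, (stdHilbertBasis ι).dense_span]
    rfl
  · rintro _ ⟨i, rfl⟩
    exact h i

variable {ι κ : Type*}

theorem orthonormal_comp_of_injective {f : ι → κ} (hf : Function.Injective f) :
    Orthonormal ℂ fun i => stdHilbertBasis κ (f i) :=
  (stdHilbertBasis κ).orthonormal.comp f hf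

/-- The isometry sending the `i`th basis vector to the `f i`th basis vector. -/
noncomputable def shiftIsometry {f : ι → κ} (hf : Function.Injective f) :
    SquareSummable ι →L[ℂ] SquareSummable κ :=
  (orthonormal_comp_of_injective hf).orthogonalFamily.linearIsometry.toContinuousLinearMap

theorem shiftIsometry_apply {f : ι → κ} (hf : Function.Injective f) (i : ι) :
    shiftIsometry hf (stdHilbertBasis ι i) = stdHilbertBasis κ (f i) := by
  classical
  rw [stdHilbertBasis_apply i]
  refine (OrthogonalFamily.linearIsometry_apply_single
    (orthonormal_comp_of_injective hf).orthogonalFamily (1 : ℂ)).trans ?_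
  simp

theorem adjoint_shiftIsometry_comp {f : ι → κ} (hf : Function.Injective f) :
    adjoint (shiftIsometry hf) ∘L shiftIsometry hf = 1 :=
  (norm_map_iff_adjoint_comp_self _).1 (LinearIsometry.norm_map _)

theorem adjoint_shiftIsometry_apply {f : ι → κ} (hf : Function.Injective f) (i : ι) :
    adjoint (shiftIsometry hf) (stdHilbertBasis κ (f i)) = stdHilbertBasis ι i := by
  rw [← shiftIsometry_apply hf, ← ContinuousLinearMap.comp_apply, adjoint_shiftIsometry_comp]
  rfl

theorem adjoint_shiftIsometry_apply_of_notMem {f : ι → κ} (hf : Function.Injective f) {k : κ}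
    (hk : k ∉ Set.range f) : adjoint (shiftIsometry hf) (stdHilbertBasis κ k) = 0 := by
  have h : innerSL ℂ (adjoint (shiftIsometry hf) (stdHilbertBasis κ k)) = 0 := by
    refine ext_stdHilbertBasis fun i => ?_
    rw [innerSL_apply_apply, adjoint_inner_left, shiftIsometry_apply,
      (stdHilbertBasis κ).orthonormal.inner_eq_zero]
    · rfl
    · rintro rfl
      exact hk ⟨i, rfl⟩
  have := congrArg (fun T => T (adjoint (shiftIsometry hf) (stdHilbertBasis κ k))) h
  simpa using this

theorem adjoint_shiftIsometry_comp_of_disjoint {ι' : Type*} {f : ι → κ} {g : ι' → κ}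
    (hf : Function.Injective f) (hg : Function.Injective g)
    (h : ∀ i j, g j ≠ f i) :
    adjoint (shiftIsometry hf) ∘L shiftIsometry hg = 0 := by
  refine ext_stdHilbertBasis fun j => ?_
  rw [ContinuousLinearMap.comp_apply, shiftIsometry_apply, adjoint_shiftIsometry_apply_of_notMem]
  · rfl
  · rintro ⟨i, hi⟩
    exact h i j hi.symm

variable {V : Type u} {A : Type v} (E : RowFiniteGraph V A)

/-- For finite nonempty r⁻¹(x) there is a bijection r⁻¹(x) × ℕ ≃ ℕ, and f e is its restriction to
the slice {e} × ℕ. Thus the edges into x cut ℕ into infinite pieces. -/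
theorem exists_injective_partition : ∃ f : A → ℕ → ℕ,
    (∀ e, Function.Injective (f e)) ∧
    ∀ x, (E.r ⁻¹' {x}).Nonempty → ∀ n, ∃! e, E.r e = x ∧ n ∈ Set.range (f e) := by
  classical
  have hφ : ∀ x, (E.r ⁻¹' {x}).Nonempty → Nonempty ((E.r ⁻¹' {x}) × ℕ ≃ ℕ) := fun x hx => by
    have := (E.rowFinite x).to_subtype
    have := hx.to_subtype
    exact nonempty_equiv_of_countable
  let φ := fun x hx => (hφ x hx).some
  refine ⟨fun e n => φ (E.r e) ⟨e, rfl⟩ (⟨e, rfl⟩, n), fun e m n h => ?_, fun x hx n => ?_⟩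
  · simpa using (φ (E.r e) ⟨e, rfl⟩).injective h
  · obtain ⟨⟨⟨e, he⟩, k⟩, rfl⟩ := (φ x hx).surjective n
    obtain rfl : E.r e = x := he
    refine ⟨e, ⟨rfl, k, rfl⟩, ?_⟩
    rintro e' ⟨h1, k', h2⟩
    -- The bijection depends on the range vertex, so r e' is generalised to y before the two
    -- vertices are identified.
    have key : ∀ y (hy : (E.r ⁻¹' {y}).Nonempty) (he' : E.r e' = y) (hy' : y = E.r e),
        φ y hy (⟨e', he'⟩, k') = φ (E.r e) hx (⟨e, rfl⟩, k) → e' = e := by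
      rintro y hy he' rfl h
      have := (φ (E.r e) hx).injective h
      simpa using (congrArg (fun p => (p.1 : A)) this)
    exact key _ ⟨e', rfl⟩ rfl h1 h2

/-- On ℓ²(V × ℕ), p_x projects onto the span of {x} × ℕ and s_e sends the basis vector (s(e), n) to
(r(e), f e n). The partition of ℕ makes the ranges of the s_e with r(e) = x fill the range of p_x.
-/
theorem exists_ckFamily_ne_zero :
    ∃ F : CKFamily E (SquareSummable (V × ℕ) →L[ℂ] SquareSummable (V × ℕ)), ∀ x, F.p x ≠ 0 := by
  classical
  obtain ⟨f, hf, hpart⟩ := E.exists_injective_partition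
  have hi : ∀ x : V, Function.Injective fun n : ℕ => (x, n) := fun x m n h => by simpa using h
  have hg : ∀ e : A, Function.Injective fun n : ℕ => (E.r e, f e n) := fun e m n h =>
    hf e (by simpa using h)
  let W := fun x => shiftIsometry (hi x)
  let U := fun e => shiftIsometry (hg e)
  have hW : ∀ x, adjoint (W x) ∘L W x = 1 := fun x => adjoint_shiftIsometry_comp _
  have hU : ∀ e, adjoint (U e) ∘L U e = 1 := fun x => adjoint_shiftIsometry_comp _
  refine ⟨{
    p := fun x => W x ∘L adjoint (W x)
    s := fun e => U e ∘L adjoint (W (E.s e))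
    isStarProjection := fun x => ⟨?_, ?_⟩
    orthogonal := fun x y h => ?_
    star_s_mul_s := fun e => ?_
    p_eq_sum := fun x hx => ?_ }, fun x h => ?_⟩
  · change (W x ∘L adjoint (W x)) ∘L (W x ∘L adjoint (W x)) = _
    rw [comp_assoc, ← comp_assoc (adjoint (W x)), hW]
    rfl
  · rw [isSelfAdjoint_iff, star_eq_adjoint, adjoint_comp, adjoint_adjoint]
  · change (W x ∘L adjoint (W x)) ∘L (W y ∘L adjoint (W y)) = 0
    rw [comp_assoc, ← comp_assoc (adjoint (W x)), adjoint_shiftIsometry_comp_of_disjoint,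
      zero_comp, comp_zero]
    intro i j hij
    exact h (congrArg Prod.fst hij).symm
  · rw [star_eq_adjoint, adjoint_comp, adjoint_adjoint]
    change (W (E.s e) ∘L adjoint (U e)) ∘L (U e ∘L adjoint (W (E.s e))) = _
    rw [comp_assoc, ← comp_assoc (adjoint (U e)), hU]
    rfl
  · have hs : ∀ e, (U e ∘L adjoint (W (E.s e))) * star (U e ∘L adjoint (W (E.s e))) =
        U e ∘L adjoint (U e) := fun e => by
      rw [star_eq_adjoint, adjoint_comp, adjoint_adjoint]
      change (U e ∘L adjoint (W (E.s e))) ∘L (W (E.s e) ∘L adjoint (U e)) = _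
      rw [comp_assoc, ← comp_assoc (adjoint (W _)), hW]
      rfl
    simp only [hs]
    -- On the basis vector (x, n) only the unique edge whose piece of ℕ contains n contributes; for
    -- y ≠ x both sides vanish.
    refine ext_stdHilbertBasis fun ⟨y, n⟩ => ?_
    rw [ContinuousLinearMap.comp_apply, _root_.sum_apply]
    simp only [ContinuousLinearMap.comp_apply]
    by_cases hxy : y = x
    · subst hxy
      have h1 : adjoint (W y) (stdHilbertBasis _ (y, n)) = stdHilbertBasis _ n :=
        adjoint_shiftIsometry_apply (hi y) n
      have h2 : W y (stdHilbertBasis _ n) = stdHilbertBasis _ (y, n) := shiftIsometry_apply (hi y) n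
      rw [h1, h2]
      obtain ⟨e, ⟨rfl, k, rfl⟩, huniq⟩ := hpart y hx n
      rw [Finset.sum_eq_single e]
      · have h1 : adjoint (U e) (stdHilbertBasis _ (E.r e, f e k)) = stdHilbertBasis _ k :=
          adjoint_shiftIsometry_apply (hg e) k
        have h2 : U e (stdHilbertBasis _ k) = stdHilbertBasis _ (E.r e, f e k) :=
          shiftIsometry_apply (hg e) k
        rw [h1, h2]
      · intro e' he' hne
        have h1 : adjoint (U e') (stdHilbertBasis _ (E.r e, f e k)) = 0 := by
          refine adjoint_shiftIsometry_apply_of_notMem (hg e') ?_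
          rintro ⟨m, hm⟩
          rw [Prod.mk.injEq] at hm
          exact hne (huniq e' ⟨hm.1, m, hm.2⟩)
        rw [h1, map_zero]
      · intro h
        simp at h
    · have h1 : adjoint (W x) (stdHilbertBasis _ (y, n)) = 0 := by
        refine adjoint_shiftIsometry_apply_of_notMem (hi x) ?_
        rintro ⟨m, hm⟩
        exact hxy (congrArg Prod.fst hm).symm
      rw [h1, map_zero, Finset.sum_eq_zero]
      intro e he
      have h1 : adjoint (U e) (stdHilbertBasis _ (y, n)) = 0 := by
        refine adjoint_shiftIsometry_apply_of_notMem (hg e) ?_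
        rintro ⟨m, hm⟩
        have he : E.r e = x := by simpa using he
        exact hxy ((congrArg Prod.fst hm).symm.trans he)
      rw [h1, map_zero]
  · have h1 : adjoint (W x) (stdHilbertBasis _ (x, 0)) = stdHilbertBasis _ 0 :=
      adjoint_shiftIsometry_apply (hi x) 0
    have h2 : W x (stdHilbertBasis _ 0) = stdHilbertBasis _ (x, 0) := shiftIsometry_apply (hi x) 0
    have h3 := congrArg (fun T => T (stdHilbertBasis _ (x, 0))) h
    simp only [ContinuousLinearMap.comp_apply, h1, h2] at h3
    exact (stdHilbertBasis _).orthonormal.ne_zero _ h3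

theorem family_p_ne_zero (x : V) : E.family.p x ≠ 0 := fun h => by
  obtain ⟨F, hF⟩ := E.exists_ckFamily_ne_zero
  refine hF x ?_
  rw [← CStar.lift_p F x, h, map_zero]

end Representation

end RowFiniteGraph

/-! ### Paths and the relations between their partial isometries -/

namespace RowFiniteGraph

section Paths

variable {V : Type u} {A : Type v} {E : RowFiniteGraph V A}

/-- The number of edges of a path. -/
def Path.length : {x y : V} → E.Path x y → ℕ
  | _, _, .vertex _ => 0
  | _, _, .cons _ α => α.length + 1

/-- The concatenation `αδ` of paths with `s α = r δ`. -/
def Path.comp : {x y z : V} → E.Path y z → E.Path x y → E.Path x z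
  | _, _, _, .vertex _, δ => δ
  | _, _, _, .cons e α, δ => .cons e (α.comp δ)

theorem Path.length_comp {x y z : V} (α : E.Path y z) (δ : E.Path x y) :
    (α.comp δ).length = α.length + δ.length := by
  induction α with
  | vertex => simp [comp, length]
  | cons e α ih => simp [comp, length, ih]; omega

theorem Path.exists_edge {x y : V} (α : E.Path x y) (h : α.length ≠ 0) : ∃ e, E.r e = y := by
  cases α with
  | vertex => simp [length] at h
  | cons e α => exact ⟨e, rfl⟩

/-- The path of length one given by an edge. -/
def Path.edge (e : A) : E.Path (E.s e) (E.r e) := .cons e (.vertex _)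

end Paths

namespace CKFamily

variable {V : Type u} {A : Type v} {E : RowFiniteGraph V A} {B : Type w} [NonUnitalCStarAlgebra B]
  (F : CKFamily E B)

theorem star_p (x : V) : star (F.p x) = F.p x := (F.isStarProjection x).isSelfAdjoint.star_eq

theorem p_mul_self (x : V) : F.p x * F.p x = F.p x := (F.isStarProjection x).isIdempotentElem

/-- Expanding (s_e p - s_e)^*(s_e p - s_e) with p = p_{s(e)} = s_e^*s_e gives four copies of p that
cancel. -/
theorem s_mul_p (e : A) : F.s e * F.p (E.s e) = F.s e := by
  rw [← sub_eq_zero, ← CStarRing.star_mul_self_eq_zero_iff]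
  simp only [star_sub, star_mul, star_p, sub_mul, mul_sub, mul_assoc]
  simp only [← mul_assoc (star (F.s e)), star_s_mul_s, p_mul_self, sub_self]

theorem isStarProjection_s_mul_star (e : A) : IsStarProjection (F.s e * star (F.s e)) where
  isIdempotentElem := by
    rw [IsIdempotentElem, mul_assoc, ← mul_assoc (star _), star_s_mul_s, ← mul_assoc, s_mul_p]
  isSelfAdjoint := IsSelfAdjoint.mul_star_self _

theorem isStarProjection_sum (x : V) :
    IsStarProjection (∑ e ∈ (E.rowFinite x).toFinset, F.s e * star (F.s e)) := by
  by_cases h : (E.r ⁻¹' {x}).Nonempty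
  · rw [← F.p_eq_sum x h]
    exact F.isStarProjection x
  · rw [Finset.sum_eq_zero]
    · exact .zero _
    · intro e he
      exact absurd ⟨e, by simpa using he⟩ h

theorem s_mul_star_mul_s (e : A) : F.s e * star (F.s e) * F.s e = F.s e := by
  rw [mul_assoc, star_s_mul_s, s_mul_p]

/-- The projection s_e s_e^* is a summand of the projection p_{r(e)}, hence is absorbed by it. -/
theorem star_s_mul_p (e : A) : star (F.s e) * F.p (E.r e) = star (F.s e) := by
  have h := IsStarProjection.mul_sum_eq (s := (E.rowFinite (E.r e)).toFinset)
    (q := fun e => F.s e * star (F.s e)) (fun e _ => F.isStarProjection_s_mul_star e)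
    (F.isStarProjection_sum _) (i := e) (by simp)
  rw [← F.p_eq_sum _ ⟨e, rfl⟩] at h
  have h2 : star (F.s e) * (F.s e * star (F.s e)) = star (F.s e) := by
    simpa [mul_assoc] using congrArg star (F.s_mul_star_mul_s e)
  rw [← h2, mul_assoc, h]

theorem p_mul_s (e : A) : F.p (E.r e) * F.s e = F.s e := by
  simpa [star_p] using congrArg star (F.star_s_mul_p e)

/-- Edges with different ranges are separated by orthogonal vertex projections; edges with the same
range have range projections summing to a projection, hence mutually orthogonal. -/
theorem star_s_mul_s_of_ne {e f : A} (h : e ≠ f) : star (F.s e) * F.s f = 0 := by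
  by_cases hr : E.r e = E.r f
  · have h0 := IsStarProjection.mul_eq_zero_of_sum (s := (E.rowFinite (E.r e)).toFinset)
      (q := fun e => F.s e * star (F.s e)) (fun e _ => F.isStarProjection_s_mul_star e)
      (F.isStarProjection_sum _) (i := e) (j := f) (by simp) (by simp [hr]) h
    have h2 : star (F.s e) * (F.s e * star (F.s e)) = star (F.s e) := by
      simpa [mul_assoc] using congrArg star (F.s_mul_star_mul_s e)
    calc star (F.s e) * F.s f
        = star (F.s e) * ((F.s e * star (F.s e)) * (F.s f * star (F.s f))) * F.s f := by
          rw [← mul_assoc (star (F.s e)), h2, mul_assoc, s_mul_star_mul_s]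
      _ = 0 := by rw [h0, mul_zero, zero_mul]
  · rw [← F.star_s_mul_p e, ← F.p_mul_s f, mul_assoc, ← mul_assoc (F.p _),
      F.orthogonal _ _ hr, zero_mul, mul_zero]

theorem p_mul_sPath {x y : V} (α : E.Path x y) : F.p y * F.sPath α = F.sPath α := by
  cases α with
  | vertex => rw [sPath, p_mul_self]
  | cons e α => rw [sPath, ← mul_assoc, p_mul_s]

theorem p_mul_sPath_of_ne {x y z : V} (h : z ≠ y) (α : E.Path x y) :
    F.p z * F.sPath α = 0 := by
  rw [← F.p_mul_sPath α, ← mul_assoc, F.orthogonal _ _ h, zero_mul]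

theorem s_mul_sPath_of_ne {x y : V} {e : A} (h : E.s e ≠ y) (α : E.Path x y) :
    F.s e * F.sPath α = 0 := by
  rw [← F.s_mul_p e, mul_assoc, F.p_mul_sPath_of_ne h, mul_zero]

theorem sPath_mul_p {x y : V} (α : E.Path x y) : F.sPath α * F.p x = F.sPath α := by
  induction α with
  | vertex => rw [sPath, p_mul_self]
  | cons e α ih => rw [sPath, mul_assoc, ih]

theorem p_mul_star_sPath {x y : V} (α : E.Path x y) :
    F.p x * star (F.sPath α) = star (F.sPath α) := by
  simpa [star_p] using congrArg star (F.sPath_mul_p α)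

theorem star_sPath_mul_sPath {x y : V} (α : E.Path x y) :
    star (F.sPath α) * F.sPath α = F.p x := by
  induction α with
  | vertex => rw [sPath, star_p, p_mul_self]
  | cons e α ih =>
    rw [sPath, star_mul, mul_assoc, ← mul_assoc (star (F.s e)), star_s_mul_s, p_mul_sPath, ih]

theorem sPath_comp {x y z : V} (α : E.Path y z) (δ : E.Path x y) :
    F.sPath (α.comp δ) = F.sPath α * F.sPath δ := by
  induction α with
  | vertex => rw [Path.comp, sPath, p_mul_sPath]
  | cons e α ih => rw [Path.comp, sPath, sPath, ih, mul_assoc]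

theorem sPath_edge (e : A) : F.sPath (Path.edge e : E.Path _ _) = F.s e := by
  rw [Path.edge, sPath, sPath, s_mul_p]

/-- For `|α| ≤ |β|`, either `s_α` and `s_β` have orthogonal ranges or `β` extends `α`. -/
theorem star_sPath_mul_sPath_eq_zero_or {x y x' y' : V} (α : E.Path x y) (β : E.Path x' y')
    (h : α.length ≤ β.length) : star (F.sPath α) * F.sPath β = 0 ∨
      ∃ δ : E.Path x' x, β.length = α.length + δ.length ∧ F.sPath β = F.sPath α * F.sPath δ := by
  induction α generalizing x' y' with
  | vertex =>
    by_cases hx : x = y'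
    · subst hx
      exact .inr ⟨β, by simp [Path.length], by rw [sPath, p_mul_sPath]⟩
    · left
      rw [sPath, star_p, p_mul_sPath_of_ne _ hx]
  | cons e α ih =>
    cases β with
    | vertex => simp [Path.length] at h
    | cons f β =>
      by_cases hef : e = f
      · subst hef
        rcases ih β (by simpa [Path.length] using h) with h0 | ⟨δ, hδ, h1⟩
        · left
          rw [sPath, sPath, star_mul, mul_assoc, ← mul_assoc (star (F.s e)), star_s_mul_s,
            p_mul_sPath, h0]
        · exact .inr ⟨δ, by simp [Path.length, hδ]; omega, by rw [sPath, sPath, h1, mul_assoc]⟩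
      · left
        rw [sPath, sPath, star_mul, mul_assoc, ← mul_assoc (star (F.s e)),
          F.star_s_mul_s_of_ne hef, zero_mul, mul_zero]

end CKFamily

/-! ### Spans of s_α s_β^* with sources in a hereditary set -/

section Span

variable {V : Type u} {A : Type v} {E : RowFiniteGraph V A}

/-- A set of vertices is hereditary if it contains the source of every edge whose range is in it. -/
def IsHereditary (E : RowFiniteGraph V A) (H : Set V) : Prop := ∀ e, E.r e ∈ H → E.s e ∈ H

/-- The linear span of the `s_α s_β^*` with common source in `H`. -/
noncomputable def pathSpan (E : RowFiniteGraph V A) (H : Set V) : Submodule ℂ E.CStar :=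
  Submodule.span ℂ {a : E.CStar | ∃ x ∈ H, ∃ (y y' : V) (α : E.Path x y) (β : E.Path x y'),
    a = E.family.sPath α * star (E.family.sPath β)}

variable {H : Set V}

theorem mem_pathSpan {x y y' : V} (hx : x ∈ H) (α : E.Path x y) (β : E.Path x y') :
    E.family.sPath α * star (E.family.sPath β) ∈ E.pathSpan H :=
  Submodule.subset_span ⟨x, hx, y, y', α, β, rfl⟩

theorem star_mem_pathSpan {a : E.CStar} (ha : a ∈ E.pathSpan H) : star a ∈ E.pathSpan H := by
  induction ha using Submodule.span_induction with
  | mem a ha =>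
    obtain ⟨x, hx, y, y', α, β, rfl⟩ := ha
    rw [star_mul, star_star]
    exact mem_pathSpan hx β α
  | zero => rw [star_zero]; exact zero_mem _
  | add a b _ _ ha hb => rw [star_add]; exact add_mem ha hb
  | smul c a _ ha => rw [star_smul]; exact Submodule.smul_mem _ _ ha

theorem mul_mem_pathSpan_of_forall {b : E.CStar}
    (h : ∀ x ∈ H, ∀ y y' (α : E.Path x y) (β : E.Path x y'),
      b * (E.family.sPath α * star (E.family.sPath β)) ∈ E.pathSpan H)
    {a : E.CStar} (ha : a ∈ E.pathSpan H) : b * a ∈ E.pathSpan H := by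
  induction ha using Submodule.span_induction with
  | mem a ha =>
    obtain ⟨x, hx, y, y', α, β, rfl⟩ := ha
    exact h x hx y y' α β
  | zero => rw [mul_zero]; exact zero_mem _
  | add a b _ _ ha hb => rw [mul_add]; exact add_mem ha hb
  | smul c a _ ha => rw [mul_smul_comm]; exact Submodule.smul_mem _ _ ha

theorem p_mul_mem_pathSpan (z : V) {a : E.CStar} (ha : a ∈ E.pathSpan H) :
    E.family.p z * a ∈ E.pathSpan H := by
  refine mul_mem_pathSpan_of_forall (fun x hx y y' α β => ?_) ha
  by_cases h : z = y
  · subst h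
    rw [← mul_assoc, CKFamily.p_mul_sPath]
    exact mem_pathSpan hx α β
  · rw [← mul_assoc, CKFamily.p_mul_sPath_of_ne _ h, zero_mul]
    exact zero_mem _

theorem s_mul_mem_pathSpan (e : A) {a : E.CStar} (ha : a ∈ E.pathSpan H) :
    E.family.s e * a ∈ E.pathSpan H := by
  refine mul_mem_pathSpan_of_forall (fun x hx y y' α β => ?_) ha
  by_cases h : E.s e = y
  · subst h
    rw [← mul_assoc, ← CKFamily.sPath]
    exact mem_pathSpan hx (.cons e α) β
  · rw [← mul_assoc, CKFamily.s_mul_sPath_of_ne _ h, zero_mul]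
    exact zero_mem _

/-- Heredity enters only when α is the vertex r(e): then s_e^* s_β^* = s_{βe}^*, and the common
source moves from r(e) to s(e). -/
theorem star_s_mul_mem_pathSpan (hH : E.IsHereditary H) (e : A) {a : E.CStar}
    (ha : a ∈ E.pathSpan H) : star (E.family.s e) * a ∈ E.pathSpan H := by
  refine mul_mem_pathSpan_of_forall (fun x hx y y' α β => ?_) ha
  cases α with
  | vertex =>
    by_cases h : E.r e = x
    · subst h
      have : star (E.family.s e) * (E.family.sPath (.vertex (E.r e)) * star (E.family.sPath β)) =
          E.family.sPath (.vertex (E.s e)) * star (E.family.sPath (β.comp (.edge e))) := by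
        rw [CKFamily.sPath_comp, CKFamily.sPath_edge, star_mul, CKFamily.sPath, CKFamily.sPath,
          ← mul_assoc, CKFamily.star_s_mul_p, ← mul_assoc]
        congr 1
        simpa [CKFamily.star_p] using (congrArg star (E.family.s_mul_p e)).symm
      rw [this]
      exact mem_pathSpan (hH e hx) _ _
    · rw [CKFamily.sPath, ← E.family.star_s_mul_p e, mul_assoc, ← mul_assoc (E.family.p _),
        E.family.orthogonal _ _ h, zero_mul, mul_zero]
      exact zero_mem _
  | cons f α =>
    by_cases h : e = f
    · subst h
      rw [CKFamily.sPath, ← mul_assoc, ← mul_assoc, CKFamily.star_s_mul_s, CKFamily.p_mul_sPath]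
      exact mem_pathSpan hx _ _
    · rw [CKFamily.sPath, ← mul_assoc, ← mul_assoc, CKFamily.star_s_mul_s_of_ne _ h, zero_mul,
        zero_mul]
      exact zero_mem _

theorem p_mem_pathSpan_univ (x : V) : E.family.p x ∈ E.pathSpan Set.univ := by
  have := mem_pathSpan (E := E) (Set.mem_univ x) (.vertex x) (.vertex x)
  rwa [CKFamily.sPath, CKFamily.star_p, CKFamily.p_mul_self] at this

theorem s_mem_pathSpan_univ (e : A) : E.family.s e ∈ E.pathSpan Set.univ := by
  have := mem_pathSpan (E := E) (Set.mem_univ _) (.edge e) (.vertex _)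
  rwa [CKFamily.sPath_edge, CKFamily.sPath, CKFamily.star_p, CKFamily.s_mul_p] at this

/-- The three claims are proved together because, for a product bc, the first needs that b preserves
the full span. -/
theorem mul_mem_pathSpan_of_mem_adjoin (hH : E.IsHereditary H) {b : E.CStar}
    (hb : b ∈ NonUnitalStarAlgebra.adjoin ℂ (Set.range E.family.p ∪ Set.range E.family.s)) :
    b ∈ E.pathSpan Set.univ ∧ (∀ a ∈ E.pathSpan Set.univ, b * a ∈ E.pathSpan Set.univ) ∧
      ∀ a ∈ E.pathSpan H, b * a ∈ E.pathSpan H := by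
  have huniv : E.IsHereditary Set.univ := fun _ _ => Set.mem_univ _
  -- Adjoining the adjoints of the generators instead of closing under star avoids a star case,
  -- which statements about left multiplication do not pass through.
  rw [← NonUnitalStarSubalgebra.mem_toNonUnitalSubalgebra,
    NonUnitalStarAlgebra.adjoin_toNonUnitalSubalgebra] at hb
  induction hb using NonUnitalAlgebra.adjoin_induction with
  | mem b hb =>
    rcases hb with (⟨x, rfl⟩ | ⟨e, rfl⟩) | (⟨x, hx⟩ | ⟨e, he⟩)
    · exact ⟨p_mem_pathSpan_univ x, fun a ha => p_mul_mem_pathSpan x ha,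
        fun a ha => p_mul_mem_pathSpan x ha⟩
    · exact ⟨s_mem_pathSpan_univ e, fun a ha => s_mul_mem_pathSpan e ha,
        fun a ha => s_mul_mem_pathSpan e ha⟩
    · obtain rfl : b = E.family.p x := by rw [← star_star b, ← hx, CKFamily.star_p]
      exact ⟨p_mem_pathSpan_univ x, fun a ha => p_mul_mem_pathSpan x ha,
        fun a ha => p_mul_mem_pathSpan x ha⟩
    · obtain rfl : b = star (E.family.s e) := by rw [he, star_star]
      exact ⟨star_mem_pathSpan (s_mem_pathSpan_univ e),
        fun a ha => star_s_mul_mem_pathSpan huniv e ha, fun a ha => star_s_mul_mem_pathSpan hH e ha⟩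
  | zero =>
    exact ⟨zero_mem _, fun a _ => by rw [zero_mul]; exact zero_mem _,
      fun a _ => by rw [zero_mul]; exact zero_mem _⟩
  | add b c _ _ hb hc =>
    exact ⟨add_mem hb.1 hc.1, fun a ha => by rw [add_mul]; exact add_mem (hb.2.1 a ha) (hc.2.1 a ha),
      fun a ha => by rw [add_mul]; exact add_mem (hb.2.2 a ha) (hc.2.2 a ha)⟩
  | mul b c _ _ hb hc =>
    exact ⟨hb.2.1 _ hc.1, fun a ha => by rw [mul_assoc]; exact hb.2.1 _ (hc.2.1 a ha),
      fun a ha => by rw [mul_assoc]; exact hb.2.2 _ (hc.2.2 a ha)⟩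
  | smul r b _ hb =>
    exact ⟨Submodule.smul_mem _ _ hb.1,
      fun a ha => by rw [smul_mul_assoc]; exact Submodule.smul_mem _ _ (hb.2.1 a ha),
      fun a ha => by rw [smul_mul_assoc]; exact Submodule.smul_mem _ _ (hb.2.2 a ha)⟩

theorem dense_pathSpan_univ (E : RowFiniteGraph V A) :
    Dense (E.pathSpan Set.univ : Set E.CStar) :=
  (CStar.dense_adjoin E).mono fun _ hb =>
    (mul_mem_pathSpan_of_mem_adjoin (H := Set.univ) (fun _ _ => Set.mem_univ _) hb).1

/-- The closed linear span of the `s_α s_β^*` with common source in `H`, as a subspace. -/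
noncomputable def pathIdeal (E : RowFiniteGraph V A) (H : Set V) : Submodule ℂ E.CStar :=
  (E.pathSpan H).topologicalClosure

theorem isClosed_pathIdeal (H : Set V) : IsClosed (E.pathIdeal H : Set E.CStar) :=
  Submodule.isClosed_topologicalClosure _

theorem pathSpan_le_pathIdeal (H : Set V) : E.pathSpan H ≤ E.pathIdeal H :=
  Submodule.le_topologicalClosure _

theorem star_mem_pathIdeal {a : E.CStar} (ha : a ∈ E.pathIdeal H) : star a ∈ E.pathIdeal H :=
  map_mem_closure continuous_star ha fun _ => star_mem_pathSpan

theorem mul_mem_pathIdeal (hH : E.IsHereditary H) (b : E.CStar) {a : E.CStar}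
    (ha : a ∈ E.pathIdeal H) : b * a ∈ E.pathIdeal H := by
  have hb : b ∈ closure (NonUnitalStarAlgebra.adjoin ℂ
      (Set.range E.family.p ∪ Set.range E.family.s) : Set E.CStar) := CStar.dense_adjoin E b
  exact map_mem_closure₂ continuous_mul hb ha fun b hb a ha =>
    (mul_mem_pathSpan_of_mem_adjoin hH hb).2.2 a ha

theorem mem_pathIdeal_of_star_mul_self_mem (hH : E.IsHereditary H) {b : E.CStar}
    (hb : star b * b ∈ E.pathIdeal H) : b ∈ E.pathIdeal H := by
  let N : NonUnitalStarSubalgebra ℂ E.CStar :=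
    { E.pathIdeal H with
      mul_mem' := fun _ hb => mul_mem_pathIdeal hH _ hb
      star_mem' := fun ha => star_mem_pathIdeal ha }
  exact N.mem_of_star_mul_self_mem (isClosed_pathIdeal H) (fun a n hn => mul_mem_pathIdeal hH a hn)
    hb

end Span

end RowFiniteGraph

/-! ### Spectral components of the gauge action -/

namespace RowFiniteGraph

section Gauge

open MeasureTheory AddCircle Filter Topology

variable {V : Type u} {A : Type v} {E : RowFiniteGraph V A}

theorem gauge_p (z : Circle) (x : V) : E.gauge z (E.family.p x) = E.family.p x :=
  CStar.lift_p _ x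

theorem gauge_s (z : Circle) (e : A) : E.gauge z (E.family.s e) = (z : ℂ) • E.family.s e :=
  CStar.lift_s _ e

theorem norm_gauge_le (z : Circle) (a : E.CStar) : ‖E.gauge z a‖ ≤ ‖a‖ :=
  NonUnitalStarAlgHom.norm_apply_le _ a

theorem continuous_gauge (z : Circle) : Continuous (E.gauge z) :=
  AddMonoidHomClass.continuous_of_bound _ 1 fun a => by simpa using norm_gauge_le z a

theorem gauge_mul (z w : Circle) (a : E.CStar) : E.gauge (z * w) a = E.gauge z (E.gauge w a) := by
  have : E.gauge (z * w) = (E.gauge z).comp (E.gauge w) := by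
    refine CStar.hom_ext (fun x => ?_) fun e => ?_
    · simp [gauge_p]
    · simp [gauge_s, smul_smul, mul_comm]
  rw [this]
  rfl

theorem gauge_one (a : E.CStar) : E.gauge 1 a = a := by
  have : E.gauge 1 = NonUnitalStarAlgHom.id ℂ E.CStar := by
    refine CStar.hom_ext (fun x => ?_) fun e => ?_
    · simp [gauge_p]
    · simp [gauge_s]
  rw [this]
  rfl

theorem gauge_sPath (z : Circle) {x y : V} (α : E.Path x y) :
    E.gauge z (E.family.sPath α) = (z : ℂ) ^ α.length • E.family.sPath α := by
  induction α with
  | vertex => simp [CKFamily.sPath, Path.length, gauge_p]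
  | cons e α ih =>
    rw [CKFamily.sPath, map_mul, ih, gauge_s, smul_mul_smul_comm, Path.length, pow_succ']

theorem gauge_sPath_mul_star (z : Circle) {x y y' : V} (α : E.Path x y) (β : E.Path x y') :
    E.gauge z (E.family.sPath α * star (E.family.sPath β)) =
      ((z : ℂ) ^ ((α.length : ℤ) - β.length)) • (E.family.sPath α * star (E.family.sPath β)) := by
  rw [map_mul, map_star, gauge_sPath, gauge_sPath, star_smul, smul_mul_smul_comm]
  congr 1
  rw [zpow_sub₀ z.coe_ne_zero, zpow_natCast, zpow_natCast, div_eq_mul_inv, star_pow, ← inv_pow]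
  congr 2
  rw [← Circle.coe_inv, Circle.coe_inv_eq_conj]
  rfl

/-- The orbit of an element under the gauge action, as a function on the additive circle. -/
noncomputable def gaugeOrbit (a : E.CStar) (t : UnitAddCircle) : E.CStar := E.gauge (toCircle t) a

theorem gaugeOrbit_sPath_mul_star {x y y' : V} (α : E.Path x y) (β : E.Path x y') :
    gaugeOrbit (E.family.sPath α * star (E.family.sPath β)) = fun t =>
      fourier ((α.length : ℤ) - β.length) t • (E.family.sPath α * star (E.family.sPath β)) := by
  funext t
  rw [gaugeOrbit, gauge_sPath_mul_star, fourier_apply, toCircle_zsmul, Circle.coe_zpow]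

/-- Orbits of elements of the path span are trigonometric polynomials. Since every γ_z is
contractive, a general orbit is a uniform limit of these. -/
theorem continuous_gaugeOrbit (a : E.CStar) : Continuous (gaugeOrbit a) := by
  have hspan : ∀ b ∈ E.pathSpan Set.univ, Continuous (gaugeOrbit b) := by
    intro b hb
    induction hb using Submodule.span_induction with
    | mem b hb =>
      obtain ⟨x, -, y, y', α, β, rfl⟩ := hb
      rw [gaugeOrbit_sPath_mul_star]
      exact (map_continuous (fourier _)).smul continuous_const
    | zero =>
      have : gaugeOrbit (0 : E.CStar) = fun _ => 0 := funext fun t => map_zero _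
      rw [this]
      exact continuous_const
    | add b c _ _ hb hc =>
      have : gaugeOrbit (b + c) = fun t => gaugeOrbit b t + gaugeOrbit c t :=
        funext fun t => map_add _ _ _
      rw [this]
      exact hb.add hc
    | smul r b _ hb =>
      have : gaugeOrbit (r • b) = fun t => r • gaugeOrbit b t := funext fun t => map_smul _ _ _
      rw [this]
      exact hb.const_smul r
  rw [Metric.continuous_iff']
  intro t ε hε
  obtain ⟨b, hb, hab⟩ := Metric.dense_iff.1 (dense_pathSpan_univ E) a (ε / 3) (by positivity)
  filter_upwards [Metric.continuous_iff'.1 (hspan b hab) t (ε / 3) (by positivity)] with s hs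
  have key : ∀ s, dist (gaugeOrbit a s) (gaugeOrbit b s) < ε / 3 := fun s => by
    rw [dist_eq_norm, gaugeOrbit, gaugeOrbit, ← map_sub]
    refine (norm_gauge_le _ _).trans_lt ?_
    rwa [← dist_eq_norm, dist_comm]
  calc dist (gaugeOrbit a s) (gaugeOrbit a t)
      ≤ dist (gaugeOrbit a s) (gaugeOrbit b s) + dist (gaugeOrbit b s) (gaugeOrbit b t) +
        dist (gaugeOrbit b t) (gaugeOrbit a t) := dist_triangle4 _ _ _ _
    _ < ε / 3 + ε / 3 + ε / 3 := by
      gcongr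
      · exact key s
      · rw [dist_comm]; exact key t
    _ = ε := by ring

theorem integrable_gaugeOrbit (a : E.CStar) : Integrable (gaugeOrbit a) haarAddCircle :=
  (continuous_gaugeOrbit a).integrable_of_hasCompactSupport (HasCompactSupport.of_compactSpace _)

/-- The `k`th spectral component of an element for the gauge action. -/
noncomputable def spectralPart (k : ℤ) (a : E.CStar) : E.CStar := fourierCoeff (gaugeOrbit a) k

theorem spectralPart_add (k : ℤ) (a b : E.CStar) :
    spectralPart k (a + b) = spectralPart k a + spectralPart k b := by
  have : gaugeOrbit (a + b) = gaugeOrbit a + gaugeOrbit b := funext fun t => map_add _ _ _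
  rw [spectralPart, this, fourierCoeff.add (integrable_gaugeOrbit a) (integrable_gaugeOrbit b)]
  rfl

theorem spectralPart_smul (k : ℤ) (c : ℂ) (a : E.CStar) :
    spectralPart k (c • a) = c • spectralPart k a := by
  have : gaugeOrbit (c • a) = c • gaugeOrbit a := funext fun t => map_smul _ _ _
  rw [spectralPart, this, fourierCoeff.const_smul]
  rfl

theorem norm_spectralPart_le (k : ℤ) (a : E.CStar) : ‖spectralPart k a‖ ≤ ‖a‖ := by
  refine (norm_integral_le_of_norm_le_const (C := ‖a‖) (.of_forall fun t => ?_)).trans ?_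
  · rw [norm_smul, fourier_apply, Circle.norm_coe, one_mul]
    exact norm_gauge_le _ _
  · simp

/-- The projection onto the `k`th spectral subspace of the gauge action. -/
noncomputable def spectralProj (k : ℤ) : E.CStar →L[ℂ] E.CStar :=
  LinearMap.mkContinuous
    { toFun := spectralPart k
      map_add' := spectralPart_add k
      map_smul' := spectralPart_smul k } 1 fun a => by simpa using norm_spectralPart_le k a

theorem spectralProj_apply (k : ℤ) (a : E.CStar) : spectralProj k a = spectralPart k a := rfl

/-- The spectral part is an average, over a probability measure, of points of the closed convex set
K. -/
theorem spectralProj_mem {K : Submodule ℂ E.CStar} (hK : IsClosed (K : Set E.CStar))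
    (hg : ∀ z, ∀ a ∈ K, E.gauge z a ∈ K) (k : ℤ) {a : E.CStar} (ha : a ∈ K) :
    spectralProj k a ∈ K := by
  refine Convex.integral_mem (s := (K : Set E.CStar)) (K.restrictScalars ℝ).convex hK
    (.of_forall fun t => K.smul_mem _ (hg _ _ ha)) ?_
  exact (integrable_gaugeOrbit a).fourier_smul _

/-- Applying γ_s inside the integral translates the variable by s, and Haar measure is translation
invariant. -/
theorem gauge_spectralProj (k : ℤ) (a : E.CStar) (s : UnitAddCircle) :
    E.gauge (toCircle s) (spectralProj k a) = fourier k s • spectralProj k a := by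
  let G : E.CStar →L[ℂ] E.CStar := ⟨(E.gauge (toCircle s) : E.CStar →ₗ[ℂ] E.CStar),
    continuous_gauge _⟩
  have h1 : E.gauge (toCircle s) (spectralProj k a) =
      ∫ t, G (fourier (-k) t • gaugeOrbit a t) ∂haarAddCircle :=
    (G.integral_comp_comm ((integrable_gaugeOrbit a).fourier_smul _)).symm
  have h2 : ∀ t, G (fourier (-k) t • gaugeOrbit a t) =
      fourier k s • (fun t => fourier (-k) t • gaugeOrbit a t) (t + s) := by
    intro t
    have h3 : G (gaugeOrbit a t) = gaugeOrbit a (t + s) := by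
      rw [gaugeOrbit, gaugeOrbit, toCircle_add, mul_comm, gauge_mul]
      rfl
    have h4 : fourier k s * fourier (-k) s = (1 : ℂ) := by
      rw [← fourier_add, add_neg_cancel, fourier_zero]
    have h5 : (fourier (-k) (t + s) : ℂ) = fourier (-k) t * fourier (-k) s := by
      simp only [fourier_apply, smul_add, toCircle_add, Circle.coe_mul]
    simp only []
    rw [map_smul, h3, smul_smul, h5, mul_left_comm, h4, mul_one]
  rw [h1]
  simp only [h2]
  rw [integral_smul, integral_add_right_eq_self (μ := haarAddCircle)
    (fun t => fourier (-k) t • gaugeOrbit a t) s]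
  rfl

theorem spectralProj_zero_of_forall {a : E.CStar} (ha : ∀ t : UnitAddCircle, E.gauge (toCircle t) a = a) :
    spectralProj 0 a = a := by
  have : ∀ t, fourier (-0) t • gaugeOrbit a t = a := fun t => by
    rw [neg_zero, fourier_zero, one_smul, gaugeOrbit, ha]
  rw [spectralProj_apply, spectralPart, fourierCoeff]
  simp only [this]
  simp

theorem spectralProj_zero_star_mul_self (k : ℤ) (a : E.CStar) :
    spectralProj 0 (star (spectralProj k a) * spectralProj k a) =
      star (spectralProj k a) * spectralProj k a := by
  refine spectralProj_zero_of_forall fun t => ?_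
  rw [map_mul, map_star, gauge_spectralProj, star_smul, smul_mul_smul_comm]
  have : star (fourier k t : ℂ) * fourier k t = 1 := by
    rw [fourier_apply, mul_comm]
    simp [Complex.mul_conj', Circle.norm_coe]
  rw [this, one_smul]

theorem spectralProj_zero_sPath_mul_star {x y y' : V} (α : E.Path x y) (β : E.Path x y') :
    spectralProj 0 (E.family.sPath α * star (E.family.sPath β)) =
      if α.length = β.length then E.family.sPath α * star (E.family.sPath β) else 0 := by
  rw [spectralProj_apply, spectralPart, gaugeOrbit_sPath_mul_star, fourierCoeff]
  simp only [← smul_assoc]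
  rw [integral_smul_const]
  have h := congrFun (fourierCoeff_fourier (T := 1) ((α.length : ℤ) - β.length)) 0
  rw [fourierCoeff] at h
  rw [h]
  split_ifs with hl
  · rw [hl, sub_self, Pi.single_eq_same, one_smul]
  · rw [Pi.single_eq_of_ne (by omega), zero_smul]

/-- If a ∉ K, some functional ℓ kills K and has ℓ(a) ≠ 0. The continuous function t ↦ ℓ(γ_t a) has
Fourier coefficients ℓ applied to the spectral parts, all zero, so it vanishes at t = 0, where its
value is ℓ(a). -/
theorem mem_of_forall_spectralProj_mem {K : Submodule ℂ E.CStar} (hK : IsClosed (K : Set E.CStar))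
    {a : E.CStar} (ha : ∀ k, spectralProj k a ∈ K) : a ∈ K := by
  have : IsClosed (K : Set E.CStar) := hK
  by_contra hn
  have hn' : ‖K.mkQL a‖ ≠ 0 := by
    rw [norm_ne_zero_iff]
    simpa using hn
  obtain ⟨g, -, hg⟩ := exists_dual_vector ℂ (K.mkQL a) hn'
  let ℓ : E.CStar →L[ℂ] ℂ := g.comp K.mkQL
  let f : C(UnitAddCircle, ℂ) := ⟨fun t => ℓ (gaugeOrbit a t),
    ℓ.continuous.comp (continuous_gaugeOrbit a)⟩
  have hf : ∀ k, fourierCoeff f k = 0 := fun k => by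
    have h1 : fourierCoeff f k = ℓ (spectralProj k a) := by
      rw [spectralProj_apply, spectralPart, fourierCoeff, fourierCoeff,
        ← ℓ.integral_comp_comm ((integrable_gaugeOrbit a).fourier_smul _)]
      simp only [map_smul]
      rfl
    rw [h1]
    have : K.mkQL (spectralProj k a) = 0 := by simpa using ha k
    simp [ℓ, this]
  -- Summability of the (zero) coefficients is what gives pointwise convergence of the Fourier
  -- series.
  have hsum : Summable (fourierCoeff f) := by
    rw [show fourierCoeff f = 0 from funext hf]
    exact summable_zero
  have h0 := has_pointwise_sum_fourier_series_of_summable hsum 0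
  simp only [hf, zero_smul] at h0
  have h1 := h0.unique hasSum_zero
  have h2 : f 0 = ℓ a := by
    simp only [f, ContinuousMap.coe_mk, gaugeOrbit, toCircle_zero, gauge_one]
  rw [h2] at h1
  apply hn'
  have : ((‖K.mkQL a‖ : ℝ) : ℂ) = 0 := hg.symm.trans h1
  exact_mod_cast this

end Gauge

end RowFiniteGraph

/-! ### Matrix units and the structure of gauge-invariant ideals -/

namespace RowFiniteGraph

section Core

variable {V : Type u} {A : Type v} {E : RowFiniteGraph V A}

/-- A path is maximal for length `n` if it has length `n`, or has length at most `n` and cannot be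
extended at its source. -/
def Path.IsMaximal (n : ℕ) {x y : V} (α : E.Path x y) : Prop :=
  α.length = n ∨ α.length ≤ n ∧ E.r ⁻¹' {x} = ∅

theorem Path.IsMaximal.length_le {n : ℕ} {x y : V} {α : E.Path x y} (h : α.IsMaximal n) :
    α.length ≤ n := h.elim (fun h => h.le) fun h => h.1

/-- A proper extension of α would exceed length n or add an edge at a source that receives none. The
conclusion s_α = s_β, with equal sources, is all that multiplying matrix units requires. -/
theorem CKFamily.star_sPath_mul_sPath_of_isMaximal {B : Type w} [NonUnitalCStarAlgebra B]
    (F : CKFamily E B) {n : ℕ} {x y x' y' : V} {α : E.Path x y} {β : E.Path x' y'}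
    (hα : α.IsMaximal n) (hβ : β.IsMaximal n) :
    star (F.sPath α) * F.sPath β = 0 ∨ F.sPath α = F.sPath β ∧ x = x' := by
  wlog h : α.length ≤ β.length generalizing x y x' y' α β
  · rcases this hβ hα (by omega) with h0 | ⟨h1, h2⟩
    · left
      simpa using congrArg star h0
    · exact .inr ⟨h1.symm, h2.symm⟩
  rcases F.star_sPath_mul_sPath_eq_zero_or α β h with h0 | ⟨δ, hl, hs⟩
  · exact .inl h0
  right
  by_cases hδ : δ.length = 0
  · cases δ with
    | vertex => exact ⟨by rw [hs, sPath, sPath_mul_p], rfl⟩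
    | cons e δ => simp [Path.length] at hδ
  · obtain ⟨e, he⟩ := δ.exists_edge hδ
    rcases hα with hα | hα
    · have := hβ.length_le
      omega
    · have : e ∈ E.r ⁻¹' {x} := he
      rw [hα.2] at this
      exact this.elim

/-- The matrix units `s_α s_β^*` with `α`, `β` maximal for length `n`, with common source in `H`,
and with `s_α`, `s_β` in `P`. -/
def matrixUnits (E : RowFiniteGraph V A) (n : ℕ) (H : Set V) (P : Set E.CStar) : Set E.CStar :=
  {a | ∃ x ∈ H, ∃ (y y' : V) (α : E.Path x y) (β : E.Path x y'), α.IsMaximal n ∧ β.IsMaximal n ∧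
    E.family.sPath α ∈ P ∧ E.family.sPath β ∈ P ∧
    a = E.family.sPath α * star (E.family.sPath β)}

theorem matrixUnits_mono (n : ℕ) (H : Set V) {P Q : Set E.CStar} (h : P ⊆ Q) :
    E.matrixUnits n H P ⊆ E.matrixUnits n H Q := by
  rintro _ ⟨x, hx, y, y', α, β, hα, hβ, hP, hP', rfl⟩
  exact ⟨x, hx, y, y', α, β, hα, hβ, h hP, h hP', rfl⟩

theorem finite_matrixUnits (n : ℕ) (H : Set V) {P : Set E.CStar} (h : P.Finite) :
    (E.matrixUnits n H P).Finite := by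
  refine (Set.Finite.image2 (fun a b => a * star b) h h).subset ?_
  rintro _ ⟨x, hx, y, y', α, β, -, -, hP, hP', rfl⟩
  exact ⟨_, hP, _, hP', rfl⟩

/-- Only finitely many paths occur in an element, so it lies in a finite-dimensional span. Paths are
recorded by their elements s_α, which avoids sets of paths with varying endpoints. -/
theorem exists_finite_mem_span_matrixUnits {n : ℕ} {H : Set V} {a : E.CStar}
    (ha : a ∈ Submodule.span ℂ (E.matrixUnits n H Set.univ)) :
    ∃ P : Set E.CStar, P.Finite ∧ a ∈ Submodule.span ℂ (E.matrixUnits n H P) := by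
  induction ha using Submodule.span_induction with
  | mem a ha =>
    obtain ⟨x, hx, y, y', α, β, hα, hβ, -, -, rfl⟩ := ha
    exact ⟨{E.family.sPath α, E.family.sPath β}, Set.toFinite _,
      Submodule.subset_span ⟨x, hx, y, y', α, β, hα, hβ, by simp, by simp, rfl⟩⟩
  | zero => exact ⟨∅, Set.finite_empty, zero_mem _⟩
  | add a b _ _ ha hb =>
    obtain ⟨P, hP, ha⟩ := ha
    obtain ⟨Q, hQ, hb⟩ := hb
    exact ⟨P ∪ Q, hP.union hQ, add_mem
      (Submodule.span_mono (matrixUnits_mono n H Set.subset_union_left) ha)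
      (Submodule.span_mono (matrixUnits_mono n H Set.subset_union_right) hb)⟩
  | smul c a _ ha =>
    obtain ⟨P, hP, ha⟩ := ha
    exact ⟨P, hP, Submodule.smul_mem _ _ ha⟩

theorem star_mem_span_matrixUnits {n : ℕ} {H : Set V} {P : Set E.CStar} {a : E.CStar}
    (ha : a ∈ Submodule.span ℂ (E.matrixUnits n H P)) :
    star a ∈ Submodule.span ℂ (E.matrixUnits n H P) := by
  induction ha using Submodule.span_induction with
  | mem a ha =>
    obtain ⟨x, hx, y, y', α, β, hα, hβ, hP, hP', rfl⟩ := ha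
    rw [star_mul, star_star]
    exact Submodule.subset_span ⟨x, hx, y', y, β, α, hβ, hα, hP', hP, rfl⟩
  | zero => rw [star_zero]; exact zero_mem _
  | add a b _ _ ha hb => rw [star_add]; exact add_mem ha hb
  | smul c a _ ha => rw [star_smul]; exact Submodule.smul_mem _ _ ha

theorem mul_mem_span_matrixUnits {n : ℕ} {H : Set V} {P : Set E.CStar} {a b : E.CStar}
    (ha : a ∈ Submodule.span ℂ (E.matrixUnits n H P))
    (hb : b ∈ Submodule.span ℂ (E.matrixUnits n H P)) :
    a * b ∈ Submodule.span ℂ (E.matrixUnits n H P) := by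
  induction ha, hb using Submodule.span_induction₂ with
  | mem_mem a b ha hb =>
    obtain ⟨x, hx, y, y', α, β, hα, hβ, hP, hP', rfl⟩ := ha
    obtain ⟨z, hz, w, w', γ, δ, hγ, hδ, hQ, hQ', rfl⟩ := hb
    rcases E.family.star_sPath_mul_sPath_of_isMaximal hβ hγ with h0 | ⟨h1, rfl⟩
    · rw [mul_assoc, ← mul_assoc (star _), h0, zero_mul, mul_zero]
      exact zero_mem _
    · rw [← h1, mul_assoc, ← mul_assoc (star _), CKFamily.star_sPath_mul_sPath,
        CKFamily.p_mul_star_sPath]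
      exact Submodule.subset_span ⟨x, hx, y, w', α, δ, hα, hδ, hP, hQ', rfl⟩
  | zero_left => rw [zero_mul]; exact zero_mem _
  | zero_right => rw [mul_zero]; exact zero_mem _
  | add_left a b c _ _ _ ha hb => rw [add_mul]; exact add_mem ha hb
  | add_right a b c _ _ _ ha hb => rw [mul_add]; exact add_mem ha hb
  | smul_left c a b _ _ h => rw [smul_mul_assoc]; exact Submodule.smul_mem _ _ h
  | smul_right c a b _ _ h => rw [mul_smul_comm]; exact Submodule.smul_mem _ _ h

/-- Compression between two maximal paths extracts a matrix coefficient, a scalar at the source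
vertex. -/
theorem exists_star_sPath_mul_mul_sPath_eq_smul {n : ℕ} {H : Set V} {P : Set E.CStar} {a : E.CStar}
    (ha : a ∈ Submodule.span ℂ (E.matrixUnits n H P)) {x y x' y' : V} {α : E.Path x y}
    {β : E.Path x' y'} (hα : α.IsMaximal n) (hβ : β.IsMaximal n) :
    ∃ c : ℂ, star (E.family.sPath α) * a * E.family.sPath β = c • E.family.p x := by
  induction ha using Submodule.span_induction with
  | mem a ha =>
    obtain ⟨z, hz, w, w', γ, δ, hγ, hδ, -, -, rfl⟩ := ha
    rcases E.family.star_sPath_mul_sPath_of_isMaximal hα hγ with h0 | ⟨h1, rfl⟩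
    · exact ⟨0, by rw [← mul_assoc, h0, zero_mul, zero_mul, zero_smul]⟩
    rcases E.family.star_sPath_mul_sPath_of_isMaximal hδ hβ with h0 | ⟨h2, rfl⟩
    · exact ⟨0, by rw [mul_assoc, mul_assoc, h0, mul_zero, mul_zero, zero_smul]⟩
    refine ⟨1, ?_⟩
    rw [← h1, ← h2, ← mul_assoc, CKFamily.star_sPath_mul_sPath, mul_assoc,
      CKFamily.star_sPath_mul_sPath, CKFamily.p_mul_self, one_smul]
  | zero => exact ⟨0, by simp⟩
  | add a b _ _ ha hb =>
    obtain ⟨c, hc⟩ := ha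
    obtain ⟨d, hd⟩ := hb
    exact ⟨c + d, by rw [mul_add, add_mul, hc, hd, add_smul]⟩
  | smul r a _ ha =>
    obtain ⟨c, hc⟩ := ha
    exact ⟨r * c, by rw [mul_smul_comm, smul_mul_assoc, hc, smul_smul]⟩

section Ideal

variable {K : Submodule ℂ E.CStar}

/-- A matrix coefficient c p_x of y lies in K although p_x ∉ K, so c = 0. Hence the algebra of
matrix units annihilates y from both sides at once. -/
theorem eq_zero_of_mem_span_matrixUnits (hl : ∀ a, ∀ k ∈ K, a * k ∈ K)
    (hr : ∀ a, ∀ k ∈ K, k * a ∈ K) {n : ℕ} {P : Set E.CStar} {y : E.CStar}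
    (hy : y ∈ Submodule.span ℂ (E.matrixUnits n {x | E.family.p x ∈ K}ᶜ P)) (hyK : y ∈ K) :
    y = 0 := by
  have key : ∀ a ∈ Submodule.span ℂ (E.matrixUnits n {x | E.family.p x ∈ K}ᶜ P),
      ∀ b ∈ Submodule.span ℂ (E.matrixUnits n {x | E.family.p x ∈ K}ᶜ P), a * y * b = 0 := by
    intro a ha b hb
    induction ha, hb using Submodule.span_induction₂ with
    | mem_mem a b ha hb =>
      obtain ⟨x, hx, _, _, α, β, hα, hβ, -, -, rfl⟩ := ha
      obtain ⟨z, hz, _, _, γ, δ, hγ, hδ, -, -, rfl⟩ := hb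
      obtain ⟨c, hc⟩ := exists_star_sPath_mul_mul_sPath_eq_smul hy hβ hγ
      have hmem : c • E.family.p x ∈ K := hc ▸ hr _ _ (hl _ _ hyK)
      have hc0 : c = 0 := by
        by_contra h
        exact hx ((K.smul_mem_iff h).1 hmem)
      calc _ = E.family.sPath α * (star (E.family.sPath β) * y * E.family.sPath γ) *
            star (E.family.sPath δ) := by simp only [mul_assoc]
        _ = 0 := by rw [hc, hc0, zero_smul, mul_zero, zero_mul]
    | zero_left => rw [zero_mul, zero_mul]
    | zero_right => rw [mul_zero]
    | add_left a b c _ _ _ ha hb => rw [add_mul, add_mul, ha, hb, add_zero]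
    | add_right a b c _ _ _ ha hb => rw [mul_add, ha, hb, add_zero]
    | smul_left c a b _ _ h => rw [smul_mul_assoc, smul_mul_assoc, h, smul_zero]
    | smul_right c a b _ _ h => rw [mul_smul_comm, h, smul_zero]
  -- Taking both factors equal to y^* gives y^* y y^* = 0, so y = 0 by two uses of the C*-identity.
  have h := key _ (star_mem_span_matrixUnits hy) _ (star_mem_span_matrixUnits hy)
  rw [← CStarRing.star_mul_self_eq_zero_iff, ← CStarRing.star_mul_self_eq_zero_iff, star_mul,
    star_star, ← mul_assoc, h, zero_mul]

theorem isHereditary_of_ideal (hl : ∀ a, ∀ k ∈ K, a * k ∈ K) (hr : ∀ a, ∀ k ∈ K, k * a ∈ K) :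
    E.IsHereditary {x | E.family.p x ∈ K} := by
  intro e he
  have : star (E.family.s e) * E.family.p (E.r e) * E.family.s e ∈ K := hr _ _ (hl _ _ he)
  rwa [CKFamily.star_s_mul_p, CKFamily.star_s_mul_s] at this

theorem pathIdeal_le (hK : IsClosed (K : Set E.CStar)) (hl : ∀ a, ∀ k ∈ K, a * k ∈ K)
    (hr : ∀ a, ∀ k ∈ K, k * a ∈ K) : E.pathIdeal {x | E.family.p x ∈ K} ≤ K := by
  refine Submodule.topologicalClosure_minimal _ (Submodule.span_le.2 ?_) hK
  rintro _ ⟨x, hx, y, y', α, β, rfl⟩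
  rw [← CKFamily.sPath_mul_p]
  exact hr _ _ (hl _ _ hx)

/-- Write the approximant as z = b + y with b over H and y off H. Since a - b ∈ K, the norm of y is
at most ‖y - (a - b)‖ = ‖z - a‖, so dropping y at most doubles the error. -/
theorem mem_pathIdeal_of_forall_approx (hK : IsClosed (K : Set E.CStar))
    (hl : ∀ a, ∀ k ∈ K, a * k ∈ K) (hr : ∀ a, ∀ k ∈ K, k * a ∈ K) {a : E.CStar} (ha : a ∈ K)
    (happ : ∀ ε > 0, ∃ n, ∃ z ∈ Submodule.span ℂ (E.matrixUnits n Set.univ Set.univ),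
      ‖z - a‖ < ε) : a ∈ E.pathIdeal {x | E.family.p x ∈ K} := by
  set H := {x | E.family.p x ∈ K} with hH
  rw [← SetLike.mem_coe, ← (isClosed_pathIdeal H).closure_eq, Metric.mem_closure_iff]
  intro ε hε
  obtain ⟨n, z, hz, hza⟩ := happ (ε / 2) (by positivity)
  have hsplit : E.matrixUnits n Set.univ Set.univ ⊆
      E.matrixUnits n H Set.univ ∪ E.matrixUnits n Hᶜ Set.univ := by
    rintro _ ⟨x, -, h⟩
    by_cases hx : x ∈ H
    · exact .inl ⟨x, hx, h⟩
    · exact .inr ⟨x, hx, h⟩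
  have hz' := Submodule.span_mono (R := ℂ) hsplit hz
  rw [Submodule.span_union, Submodule.mem_sup] at hz'
  obtain ⟨b, hb, y, hy, rfl⟩ := hz'
  have hbI : b ∈ E.pathIdeal H := by
    refine pathSpan_le_pathIdeal H (Submodule.span_mono ?_ hb)
    rintro _ ⟨x, hx, y, y', α, β, -, -, -, -, rfl⟩
    exact ⟨x, hx, y, y', α, β, rfl⟩
  obtain ⟨P, hP, hyP⟩ := exists_finite_mem_span_matrixUnits hy
  have : FiniteDimensional ℂ (Submodule.span ℂ (E.matrixUnits n Hᶜ P)) :=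
    FiniteDimensional.span_of_finite ℂ (finite_matrixUnits n Hᶜ hP)
  have hyn : ‖y‖ ≤ ‖y - (a - b)‖ := norm_le_norm_sub_of_disjoint _ K
    (fun _ h _ h' => mul_mem_span_matrixUnits h h') (fun _ h => star_mem_span_matrixUnits h) hK hl
    hr (fun x hx hxK => eq_zero_of_mem_span_matrixUnits hl hr hx hxK) hyP
    (K.sub_mem ha (pathIdeal_le hK hl hr hbI))
  refine ⟨b, hbI, ?_⟩
  rw [dist_comm, dist_eq_norm]
  have h1 : y - (a - b) = b + y - a := by abel
  have h2 : b - a = (b + y - a) - y := by abel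
  rw [h1] at hyn
  rw [h2]
  calc _ ≤ ‖b + y - a‖ + ‖y‖ := norm_sub_le _ _
    _ < ε := by linarith

end Ideal

/-- Insert p_x = ∑ s_e s_e^* between s_α and s_β^*. This fails when x receives no edge, which is why
such shorter paths count as maximal. -/
theorem span_matrixUnits_le_succ (n : ℕ) :
    Submodule.span ℂ (E.matrixUnits n Set.univ Set.univ) ≤
      Submodule.span ℂ (E.matrixUnits (n + 1) Set.univ Set.univ) := by
  refine Submodule.span_le.2 ?_
  rintro _ ⟨x, -, y, y', α, β, hα, hβ, -, -, rfl⟩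
  by_cases hx : E.r ⁻¹' {x} = ∅
  · exact Submodule.subset_span ⟨x, trivial, y, y', α, β, .inr ⟨by have := hα.length_le; omega, hx⟩,
      .inr ⟨by have := hβ.length_le; omega, hx⟩, trivial, trivial, rfl⟩
  · have hα' : α.length = n := hα.resolve_right fun h => hx h.2
    have hβ' : β.length = n := hβ.resolve_right fun h => hx h.2
    rw [← CKFamily.sPath_mul_p, E.family.p_eq_sum x (Set.nonempty_iff_ne_empty.2 hx),
      Finset.mul_sum, Finset.sum_mul]
    refine Submodule.sum_mem _ fun e he => ?_
    obtain rfl : E.r e = x := by simpa using he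
    refine Submodule.subset_span ⟨E.s e, trivial, y, y', α.comp (.edge e), β.comp (.edge e),
      .inl ?_, .inl ?_, trivial, trivial, ?_⟩
    · simp [Path.length_comp, Path.edge, Path.length, hα']
    · simp [Path.length_comp, Path.edge, Path.length, hβ']
    · rw [CKFamily.sPath_comp, CKFamily.sPath_comp, CKFamily.sPath_edge, star_mul, mul_assoc,
        mul_assoc, mul_assoc]

theorem monotone_span_matrixUnits :
    Monotone fun n => Submodule.span ℂ (E.matrixUnits n Set.univ Set.univ) :=
  monotone_nat_of_le_succ span_matrixUnits_le_succ

theorem exists_spectralProj_zero_mem {a : E.CStar} (ha : a ∈ E.pathSpan Set.univ) :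
    ∃ n, spectralProj 0 a ∈ Submodule.span ℂ (E.matrixUnits n Set.univ Set.univ) := by
  induction ha using Submodule.span_induction with
  | mem a ha =>
    obtain ⟨x, -, y, y', α, β, rfl⟩ := ha
    rw [spectralProj_zero_sPath_mul_star]
    split_ifs with h
    · exact ⟨β.length, Submodule.subset_span
        ⟨x, trivial, y, y', α, β, .inl h, .inl rfl, trivial, trivial, rfl⟩⟩
    · exact ⟨0, zero_mem _⟩
  | zero => exact ⟨0, by rw [map_zero]; exact zero_mem _⟩
  | add a b _ _ ha hb =>
    obtain ⟨n, ha⟩ := ha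
    obtain ⟨m, hb⟩ := hb
    exact ⟨max n m, by
      rw [map_add]
      exact add_mem (monotone_span_matrixUnits (le_max_left n m) ha)
        (monotone_span_matrixUnits (le_max_right n m) hb)⟩
  | smul c a _ ha =>
    obtain ⟨n, ha⟩ := ha
    exact ⟨n, by rw [map_smul]; exact Submodule.smul_mem _ _ ha⟩

/-- A closed gauge-invariant ideal is generated by the vertex projections it contains. -/
theorem eq_pathIdeal_of_gaugeInvariant {K : Submodule ℂ E.CStar} (hK : IsClosed (K : Set E.CStar))
    (hl : ∀ a, ∀ k ∈ K, a * k ∈ K) (hr : ∀ a, ∀ k ∈ K, k * a ∈ K)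
    (hg : ∀ z, ∀ a ∈ K, E.gauge z a ∈ K) : K = E.pathIdeal {x | E.family.p x ∈ K} := by
  refine le_antisymm (fun a ha => ?_) (pathIdeal_le hK hl hr)
  -- Reduce to the spectral parts b of a, then to b^*b, which is gauge-fixed and still lies in K.
  refine mem_of_forall_spectralProj_mem (isClosed_pathIdeal _) fun k => ?_
  refine mem_pathIdeal_of_star_mul_self_mem (isHereditary_of_ideal hl hr) ?_
  refine mem_pathIdeal_of_forall_approx hK hl hr (hl _ _ (spectralProj_mem hK hg k ha))
    fun ε hε => ?_
  -- Being gauge-fixed, the element is its own degree-zero part, so the contraction `spectralProj 0`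
  -- carries approximants from the path span to combinations of matrix units.
  rw [← spectralProj_zero_star_mul_self]
  obtain ⟨b, hb, hbS⟩ := Metric.dense_iff.1 (dense_pathSpan_univ E)
    (star (spectralProj k a) * spectralProj k a) ε hε
  obtain ⟨n, hn⟩ := exists_spectralProj_zero_mem hbS
  refine ⟨n, _, hn, ?_⟩
  rw [← map_sub]
  exact (norm_spectralPart_le 0 _).trans_lt (by rwa [← dist_eq_norm])

end Core

/-! ### Annihilators of gauge-invariant ideals -/

section Annihilators

variable {V : Type u} {A : Type v} {E : RowFiniteGraph V A}

/-- The annihilator of a subspace, as a subspace. -/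
def perpSubmodule {B : Type w} [NonUnitalRing B] [Module ℂ B] [SMulCommClass ℂ B B]
    [IsScalarTower ℂ B B] (X : Set B) : Submodule ℂ B where
  carrier := perp X
  add_mem' ha hb x hx := by
    rw [add_mul, mul_add, (ha x hx).1, (ha x hx).2, (hb x hx).1, (hb x hx).2]
    simp
  zero_mem' x _ := by simp
  smul_mem' c a ha x hx := by
    rw [smul_mul_assoc, mul_smul_comm, (ha x hx).1, (ha x hx).2]
    simp

theorem isClosed_perp {B : Type w} [NonUnitalCStarAlgebra B] (X : Set B) : IsClosed (perp X) := by
  have : perp X = ⋂ x ∈ X, {a | a * x = 0} ∩ {a | x * a = 0} := by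
    ext a
    simp [perp]
  rw [this]
  refine isClosed_biInter fun x _ => IsClosed.inter ?_ ?_
  · exact isClosed_eq (continuous_mul_const x) continuous_const
  · exact isClosed_eq (continuous_const_mul x) continuous_const

/-- The properties of a subspace shared by closed gauge-invariant ideals and their annihilators. -/
structure IsGaugeIdeal (K : Submodule ℂ E.CStar) : Prop where
  isClosed : IsClosed (K : Set E.CStar)
  mul_mem_left : ∀ a, ∀ k ∈ K, a * k ∈ K
  mul_mem_right : ∀ a, ∀ k ∈ K, k * a ∈ K
  gauge_mem : ∀ z, ∀ a ∈ K, E.gauge z a ∈ K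

theorem IsGaugeIdeal.perp {K : Submodule ℂ E.CStar} (hK : IsGaugeIdeal K) :
    IsGaugeIdeal (perpSubmodule (K : Set E.CStar)) where
  isClosed := isClosed_perp _
  mul_mem_left a k hk x hx :=
    ⟨by rw [mul_assoc, (hk x hx).1, mul_zero],
      by rw [← mul_assoc, (hk _ (hK.mul_mem_right a x hx)).2]⟩
  mul_mem_right a k hk x hx :=
    ⟨by rw [mul_assoc, (hk _ (hK.mul_mem_left a x hx)).1],
      by rw [← mul_assoc, (hk x hx).2, zero_mul]⟩
  gauge_mem z a ha x hx := by
    -- Invariance of the annihilator comes from γ_z(a) x = γ_z(a γ_{z⁻¹}(x)), and similarly on the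
    -- other side.
    have h1 : E.gauge z (E.gauge z⁻¹ x) = x := by rw [← gauge_mul, mul_inv_cancel, gauge_one]
    have h2 := ha _ (hK.gauge_mem z⁻¹ x hx)
    rw [← h1, ← map_mul, ← map_mul, h2.1, h2.2, map_zero]
    exact ⟨rfl, rfl⟩

theorem IsGaugeIdeal.eq_pathIdeal {K : Submodule ℂ E.CStar} (hK : IsGaugeIdeal K) :
    K = E.pathIdeal {x | E.family.p x ∈ K} :=
  eq_pathIdeal_of_gaugeInvariant hK.isClosed hK.mul_mem_left hK.mul_mem_right hK.gauge_mem

/-- The ranges of paths with source in `H`. -/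
def rangesFrom (E : RowFiniteGraph V A) (H : Set V) : Set V :=
  {y | ∃ x ∈ H, Nonempty (E.Path x y)}

/-- If α runs from a vertex x with p_x ∈ K to w, then p_w s_α = s_α is a nonzero element of K, since
s_α^*s_α = p_x ≠ 0. If no such α exists, p_w is orthogonal to the generators s_α s_β^* of K = I(H),
hence to K. -/
theorem IsGaugeIdeal.setOf_p_mem_perp {K : Submodule ℂ E.CStar} (hK : IsGaugeIdeal K) :
    {x | E.family.p x ∈ perpSubmodule (K : Set E.CStar)} =
      (E.rangesFrom {x | E.family.p x ∈ K})ᶜ := by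
  ext w
  constructor
  · rintro hw ⟨x, hx, ⟨α⟩⟩
    have hα : E.family.sPath α ∈ K := by
      rw [← CKFamily.sPath_mul_p]
      exact hK.mul_mem_left _ _ hx
    have h0 : E.family.p w * E.family.sPath α = 0 := (hw _ hα).1
    rw [CKFamily.p_mul_sPath] at h0
    refine E.family_p_ne_zero x ?_
    rw [← E.family.star_sPath_mul_sPath α, h0, mul_zero]
  · intro hw a ha
    change a ∈ K at ha
    rw [hK.eq_pathIdeal] at ha
    have hsub : (E.pathSpan {x | E.family.p x ∈ K} : Set E.CStar) ⊆
        {a | E.family.p w * a = 0 ∧ a * E.family.p w = 0} := by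
      intro a ha
      have ha' : a ∈ E.pathSpan {x | E.family.p x ∈ K} := ha
      clear ha
      induction ha' using Submodule.span_induction with
      | mem a ha =>
        obtain ⟨x, hx, y, y', α, β, rfl⟩ := ha
        have hy : w ≠ y := by rintro rfl; exact hw ⟨x, hx, ⟨α⟩⟩
        have hy' : w ≠ y' := by rintro rfl; exact hw ⟨x, hx, ⟨β⟩⟩
        constructor
        · rw [← mul_assoc, CKFamily.p_mul_sPath_of_ne _ hy, zero_mul]
        · have := congrArg star (E.family.p_mul_sPath_of_ne hy' β)
          rw [star_mul, CKFamily.star_p, star_zero] at this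
          rw [mul_assoc, this, mul_zero]
      | zero => simp
      | add a b _ _ ha hb =>
        exact ⟨by rw [mul_add, ha.1, hb.1, add_zero], by rw [add_mul, ha.2, hb.2, add_zero]⟩
      | smul c a _ ha =>
        exact ⟨by rw [mul_smul_comm, ha.1, smul_zero], by rw [smul_mul_assoc, ha.2, smul_zero]⟩
    refine closure_minimal hsub ?_ ha
    exact (isClosed_eq (continuous_const_mul _) continuous_const).inter
      (isClosed_eq (continuous_mul_const _) continuous_const)

theorem compl_rangesFrom_compl_rangesFrom (E : RowFiniteGraph V A) (H : Set V) :
    (E.rangesFrom (E.rangesFrom H)ᶜ)ᶜ = {w | E.T w ⊆ E.rangesFrom H} := by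
  ext w
  constructor
  · intro hw x hx
    by_contra hn
    exact hw ⟨x, hn, hx⟩
  · rintro hw ⟨x, hx, hα⟩
    exact hx (hw hα)

end Annihilators

end RowFiniteGraph

/-! ### Annihilators and regularity of J -/

theorem mainTheorem2 {V : Type u} {A : Type v} (E : RowFiniteGraph V A)
    (J : TwoSidedIdeal E.CStar) (hclosed : IsClosed (J : Set E.CStar))
    (hgauge : RowFiniteGraph.IsGaugeInvariant J) :
    RowFiniteGraph.perp (J : Set E.CStar) =
        E.idealOf (RowFiniteGraph.vertexSetBar J)ᶜ ∧
      RowFiniteGraph.perp (RowFiniteGraph.perp (J : Set E.CStar)) =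
        E.idealOf {w : V | E.T w ⊆ RowFiniteGraph.vertexSetBar J} ∧
      (RowFiniteGraph.IsRegularIdeal J ↔
        RowFiniteGraph.vertexSet J = {w : V | E.T w ⊆ RowFiniteGraph.vertexSetBar J}) := by
  open RowFiniteGraph in
  let K : Submodule ℂ E.CStar :=
    { carrier := J
      add_mem' := J.add_mem
      zero_mem' := J.zero_mem
      smul_mem' := fun c _ ha => J.smul_mem_of_isClosed hclosed c ha }
  have hK : IsGaugeIdeal K :=
    ⟨hclosed, fun a k hk => J.mul_mem_left a k hk, fun a k hk => J.mul_mem_right k a hk, hgauge⟩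
  -- Two applications of the vertex computation identify the vertices of J^⊥⊥.
  have h1 := hK.perp.setOf_p_mem_perp
  rw [hK.setOf_p_mem_perp, compl_rangesFrom_compl_rangesFrom] at h1
  have e0 : (J : Set E.CStar) = E.idealOf (vertexSet J) :=
    congrArg (fun S : Submodule ℂ E.CStar => (S : Set E.CStar)) hK.eq_pathIdeal
  have e1 : perp (J : Set E.CStar) = E.idealOf (vertexSetBar J)ᶜ := by
    have h := hK.perp.eq_pathIdeal
    rw [hK.setOf_p_mem_perp] at h
    exact congrArg (fun S : Submodule ℂ E.CStar => (S : Set E.CStar)) h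
  have e2 : perp (perp (J : Set E.CStar)) = E.idealOf {w : V | E.T w ⊆ vertexSetBar J} := by
    have h := hK.perp.perp.eq_pathIdeal
    rw [h1] at h
    exact congrArg (fun S : Submodule ℂ E.CStar => (S : Set E.CStar)) h
  refine ⟨e1, e2, fun h => ?_, fun h => ?_⟩
  -- Equal ideals contain the same vertex projections; the converse direction uses J = I(H(J)).
  · refine Eq.trans ?_ h1
    ext w
    have h' : (J : Set E.CStar) = perp (perp (J : Set E.CStar)) := h
    exact Set.ext_iff.1 h' (E.family.p w)
  · change (J : Set E.CStar) = _
    rw [e2, ← h]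
    exact e0
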